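/- $\mathsf{ACA}_0$ proves that every $T_3$ scattered CSCS with a Cantor--Bendixson rank is homeomorphic to a subspace of a well order. In semantic form (equivalent by Gödel's completeness theorem): let $(M,\mathcal S)$, with $\mathcal S\subseteq\mathcal P(M)$, be any model of $\mathsf{ACA}_0$ (possibly nonstandard); then $(M,\mathcal S)$ satisfies the statement "every $T_3$ scattered CSCS with a rank is homeomorphic to a subspace of a well order". All objects below are elements of $M$ or are coded by members of $\mathcal S$, using the pairing $(i,j)=(i+j)^2+i$. A CSCS (countable second countable space) is a triple $(X,(U_i)_i,k)$ with $X$ a set of numbers, $(U_i)_i$ a number-indexed sequence of subsets of $X$ that covers $X$, and $k$ a function from $X\times M\times M$ to $M$ such that $x\in U_i\cap U_j$ implies $x\in U_{k(x,i,j)}\subseteq U_i\cap U_j$; the $U_i$ form a basis of its topology. It is $T_3$ if it is $T_0$ and regular: whenever $x\in U_i$ there is $j$ with $x\in U_j\subseteq\overline{U_j}\subseteq U_i$. It is scattered if every nonempty subspace $A\subseteq X$ (with $A\in\mathcal S$) has an isolated point. For a subspace $A$, let $D(A)$ be the set of non-isolated points of $A$. A well order is a linear order $(W,<_W)$ such that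 every nonempty subset of $W$ belonging to $\mathcal S$ has a least element. A rank for $X$ is a well order $R$ for which there is a sequence $(X_r)_{r\in R}$ of sets such that $X_0=X$ for $0=\min R$; $X_{r+1}=D(X_r)$ for every non-maximal $r$; $X_r=\bigcap_{s<_R r}X_s$ for every limit $r$; and $D\big(\bigcap_{r\in R}X_r\big)=\bigcap_{r\in R}X_r$. The conclusion is that there are a well order $W$, a set $Y\subseteq W$ in $\mathcal S$, and a bijection $f:X\to Y$ whose graph is in $\mathcal S$, such that $f$ is a homeomorphism when $Y$ carries the subspace topology induced by the order topology of $W$ (whose basis consists of the open intervals with end points in $W\cup\{\pm\infty\}$). -/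

import Mathlib

universe u

namespace SOA

/-- A structure for the two-sorted language of second-order arithmetic: a number domain with
`0, 1, +, ·, <` and a collection of subsets of the number domain over which the set variables
range. The number domain may be nonstandard, and not every subset has to be in `Sets`. -/
structure SOStructure where
  Num : Type u
  zero : Num
  one : Num
  add : Num → Num → Num
  mul : Num → Num → Num
  lt : Num → Num → Prop
  Sets : Set (Set Num)

/-- Function symbols of first-order arithmetic. -/
inductive ArithFunc : ℕ → Type
  | zero : ArithFunc 0
  | one : ArithFunc 0
  | add : ArithFunc 2
  | mul : ArithFunc 2

/-- Relation symbols: `<`, and for every set `A` of the structure the predicate `· ∈ A`. -/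
inductive ArithRel (𝓜 : SOStructure.{u}) : ℕ → Type u
  | lt : ArithRel 𝓜 2
  | mem (A : 𝓜.Sets) : ArithRel 𝓜 1

/-- The language of first-order arithmetic with the sets of `𝓜` as unary predicates. Its formulas
are exactly the arithmetical formulas (no set quantifiers) with set parameters from `𝓜`. -/
def arithLang (𝓜 : SOStructure.{u}) : FirstOrder.Language.{0, u} where
  Functions := ArithFunc
  Relations := ArithRel 𝓜

instance arithStructure (𝓜 : SOStructure.{u}) : (arithLang 𝓜).Structure 𝓜.Num where
  funMap := fun f => match f with
    | .zero => fun _ => 𝓜.zero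
    | .one => fun _ => 𝓜.one
    | .add => fun v => 𝓜.add (v 0) (v 1)
    | .mul => fun v => 𝓜.mul (v 0) (v 1)
  RelMap := fun r => match r with
    | .lt => fun v => 𝓜.lt (v 0) (v 1)
    | .mem A => fun v => v 0 ∈ (A : Set 𝓜.Num)

namespace SOStructure

variable (𝓜 : SOStructure.{u})

/-- `𝓜` is a model of `ACA₀`: the basic axioms, the induction axiom for sets, and comprehension
for all arithmetical formulas with number and set parameters. -/
structure IsModelACA0 : Prop where
  add_one_ne_zero : ∀ n, 𝓜.add n 𝓜.one ≠ 𝓜.zero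
  add_one_inj : ∀ m n, 𝓜.add m 𝓜.one = 𝓜.add n 𝓜.one → m = n
  add_zero : ∀ m, 𝓜.add m 𝓜.zero = m
  add_succ : ∀ m n, 𝓜.add m (𝓜.add n 𝓜.one) = 𝓜.add (𝓜.add m n) 𝓜.one
  mul_zero : ∀ m, 𝓜.mul m 𝓜.zero = 𝓜.zero
  mul_succ : ∀ m n, 𝓜.mul m (𝓜.add n 𝓜.one) = 𝓜.add (𝓜.mul m n) m
  not_lt_zero : ∀ m, ¬ 𝓜.lt m 𝓜.zero
  lt_succ : ∀ m n, 𝓜.lt m (𝓜.add n 𝓜.one) ↔ (𝓜.lt m n ∨ m = n)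
  induction : ∀ A ∈ 𝓜.Sets, 𝓜.zero ∈ A → (∀ n, n ∈ A → 𝓜.add n 𝓜.one ∈ A) → ∀ n, n ∈ A
  arithmetical_comprehension : ∀ A : Set 𝓜.Num,
    (Set.univ : Set 𝓜.Num).Definable₁ (arithLang 𝓜) A → A ∈ 𝓜.Sets

/-- The usual pairing `(i, j) = (i + j)² + i` of second-order arithmetic. -/
def pair (i j : 𝓜.Num) : 𝓜.Num :=
  𝓜.add (𝓜.mul (𝓜.add i j) (𝓜.add i j)) i

/-- The `i`-th member of the sequence of sets coded by `A`. -/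
def sec (A : Set 𝓜.Num) (i : 𝓜.Num) : Set 𝓜.Num :=
  {x | 𝓜.pair x i ∈ A}

/-- A countable second countable space `(X, (U_i), k)` of the structure: `pts` is `X`, `base` codes
`(U_i)`, and `inter` is the graph of the function `k : X × ℕ × ℕ → ℕ`. -/
structure CSCS where
  pts : Set 𝓜.Num
  base : Set 𝓜.Num
  inter : Set 𝓜.Num
  pts_mem : pts ∈ 𝓜.Sets
  base_mem : base ∈ 𝓜.Sets
  inter_mem : inter ∈ 𝓜.Sets
  base_subset : ∀ i, 𝓜.sec base i ⊆ pts
  cover : ∀ x ∈ pts, ∃ i, x ∈ 𝓜.sec base i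
  inter_function : ∀ x ∈ pts, ∀ i j, ∃! m, 𝓜.pair (𝓜.pair (𝓜.pair x i) j) m ∈ inter
  inter_spec : ∀ x ∈ pts, ∀ i j m, 𝓜.pair (𝓜.pair (𝓜.pair x i) j) m ∈ inter →
    x ∈ 𝓜.sec base i → x ∈ 𝓜.sec base j →
      x ∈ 𝓜.sec base m ∧ 𝓜.sec base m ⊆ 𝓜.sec base i ∩ 𝓜.sec base j

/-- A (strict) linear order of the structure. -/
structure LinOrd where
  field : Set 𝓜.Num
  rel : Set 𝓜.Num
  field_mem : field ∈ 𝓜.Sets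
  rel_mem : rel ∈ 𝓜.Sets
  rel_field : ∀ a b, 𝓜.pair a b ∈ rel → a ∈ field ∧ b ∈ field
  irrefl : ∀ a, 𝓜.pair a a ∉ rel
  trans : ∀ a b c, 𝓜.pair a b ∈ rel → 𝓜.pair b c ∈ rel → 𝓜.pair a c ∈ rel
  total : ∀ a ∈ field, ∀ b ∈ field, 𝓜.pair a b ∈ rel ∨ a = b ∨ 𝓜.pair b a ∈ rel

/-- The set `F` of the structure is (the graph of) a homeomorphism from the space with point set `A`
and topology generated by the basis `U` onto the subspace with point set `B` of a space with
basis `V`. -/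
structure IsHomeo {ι κ : Type*} (A : Set 𝓜.Num) (U : ι → Set 𝓜.Num) (B : Set 𝓜.Num)
    (V : κ → Set 𝓜.Num) (F : Set 𝓜.Num) : Prop where
  mem : F ∈ 𝓜.Sets
  subset : ∀ x y, 𝓜.pair x y ∈ F → x ∈ A ∧ y ∈ B
  defined : ∀ x ∈ A, ∃ y, 𝓜.pair x y ∈ F
  unique : ∀ x y y', 𝓜.pair x y ∈ F → 𝓜.pair x y' ∈ F → y = y'
  injective : ∀ x x' y, 𝓜.pair x y ∈ F → 𝓜.pair x' y ∈ F → x = x'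
  surjective : ∀ y ∈ B, ∃ x, 𝓜.pair x y ∈ F
  continuous : ∀ x y, 𝓜.pair x y ∈ F → ∀ j, y ∈ V j →
    ∃ i, x ∈ U i ∧ ∀ x' y', 𝓜.pair x' y' ∈ F → x' ∈ U i → y' ∈ V j
  isOpen : ∀ x y, 𝓜.pair x y ∈ F → ∀ i, x ∈ U i →
    ∃ j, y ∈ V j ∧ ∀ x' y', 𝓜.pair x' y' ∈ F → y' ∈ V j → x' ∈ U i

end SOStructure

namespace SOStructure.LinOrd

variable {𝓜 : SOStructure.{u}} (L : 𝓜.LinOrd)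

/-- The strict order relation. -/
def lt (a b : 𝓜.Num) : Prop := 𝓜.pair a b ∈ L.rel

/-- Every nonempty set of the structure contained in the order has a least element. -/
def IsWellOrder : Prop :=
  ∀ A ∈ 𝓜.Sets, A ⊆ L.field → A.Nonempty → ∃ a ∈ A, ∀ b ∈ A, ¬ L.lt b a

/-- `r` is the least element `0` of the order. -/
def IsBot (r : 𝓜.Num) : Prop := r ∈ L.field ∧ ∀ s ∈ L.field, ¬ L.lt s r

/-- `s` is the immediate successor `r + 1` of `r`. -/
def IsSucc (r s : 𝓜.Num) : Prop := L.lt r s ∧ ¬ ∃ t, L.lt r t ∧ L.lt t s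

/-- `r` is a limit: neither the least element nor an immediate successor. -/
def IsLimit (r : 𝓜.Num) : Prop := r ∈ L.field ∧ ¬ L.IsBot r ∧ ¬ ∃ s, L.IsSucc s r

/-- The open interval with the given end points, where a missing left (right) end point stands
for `-∞` (`+∞`). These intervals form the usual basis of the order topology. -/
def interval (e : Option 𝓜.Num × Option 𝓜.Num) : Set 𝓜.Num :=
  {y | y ∈ L.field ∧ (∀ a ∈ e.1, L.lt a y) ∧ (∀ b ∈ e.2, L.lt y b)}

end SOStructure.LinOrd

namespace SOStructure.CSCS

variable {𝓜 : SOStructure.{u}} (X : 𝓜.CSCS)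

/-- The basic open set `U_i`. -/
def U (i : 𝓜.Num) : Set 𝓜.Num := 𝓜.sec X.base i

/-- The closure in `X` of a set of points. -/
def cl (A : Set 𝓜.Num) : Set 𝓜.Num :=
  {y | y ∈ X.pts ∧ ∀ i, y ∈ X.U i → ∃ z ∈ A, z ∈ X.U i}

/-- `T₃`: distinct points are topologically distinguishable and the space is regular
(such a space is Hausdorff). -/
def IsT3 : Prop :=
  (∀ x ∈ X.pts, ∀ y ∈ X.pts, x ≠ y → ∃ i, ¬ (x ∈ X.U i ↔ y ∈ X.U i)) ∧
  (∀ x ∈ X.pts, ∀ i, x ∈ X.U i → ∃ j, x ∈ X.U j ∧ X.cl (X.U j) ⊆ X.U i)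

/-- `x` is an isolated point of the subspace `A`. -/
def IsIsolated (A : Set 𝓜.Num) (x : 𝓜.Num) : Prop :=
  x ∈ A ∧ ∃ i, x ∈ X.U i ∧ ∀ y ∈ A, y ∈ X.U i → y = x

/-- The set of limit points `D(A)` of the subspace `A`. -/
def deriv (A : Set 𝓜.Num) : Set 𝓜.Num := {x | x ∈ A ∧ ¬ X.IsIsolated A x}

/-- Every nonempty subspace has an isolated point. -/
def IsScattered : Prop :=
  ∀ A ∈ 𝓜.Sets, A ⊆ X.pts → A.Nonempty → ∃ x, X.IsIsolated A x

/-- `R` is a Cantor–Bendixson rank of `X`, witnessed by the sequence `(X_r)` coded by `Z`. -/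
structure IsRankWith (R : 𝓜.LinOrd) (Z : Set 𝓜.Num) : Prop where
  wellOrder : R.IsWellOrder
  mem : Z ∈ 𝓜.Sets
  bot : ∀ r, R.IsBot r → 𝓜.sec Z r = X.pts
  succ : ∀ r s, R.IsSucc r s → 𝓜.sec Z s = X.deriv (𝓜.sec Z r)
  limit : ∀ r, R.IsLimit r → 𝓜.sec Z r = {x | ∀ s, R.lt s r → x ∈ 𝓜.sec Z s}
  stable : X.deriv {x | x ∈ X.pts ∧ ∀ r ∈ R.field, x ∈ 𝓜.sec Z r} =
    {x | x ∈ X.pts ∧ ∀ r ∈ R.field, x ∈ 𝓜.sec Z r}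

/-- `X` has a Cantor–Bendixson rank (in the structure). -/
def HasRank : Prop := ∃ R Z, X.IsRankWith R Z

/-- `X` is homeomorphic (in the structure) to a subspace of a well order with the order topology. -/
def EmbedsInWellOrder : Prop :=
  ∃ W : 𝓜.LinOrd, W.IsWellOrder ∧ ∃ Y ∈ 𝓜.Sets, Y ⊆ W.field ∧
    ∃ F, 𝓜.IsHomeo X.pts X.U Y W.interval F

end SOStructure.CSCS

end SOA

/-! A countable regular second countable space is zero-dimensional: visit the points in order of
their codes, give each a neighbourhood whose closure misses one of two disjoint closed sets, and add
that closure to the other one. The two unions of neighbourhoods are disjoint, open and cover the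
space. Only finitely many earlier choices matter at each stage, so coded recursion does this
arithmetically, uniformly for all pairs `cl U_j ⊆ U_i`. The result is a sequence of clopen sets
`B_n` that form a basis. Agreement on `B_0, …, B_{n-1}` cuts the space into the classes of level
`n`, a binary tree of clopen sets.

In a scattered space with a rank, every point has strictly maximal rank in its classes of
sufficiently high level; it is their top. This dictates an order. A class with top `t` consists of
`t` and the pieces that split off from `t` at successive levels; the pieces are put in order of
level and `t` comes last. A class without a top is the disjoint union of its maximal subclasses that
have one; these are put in order of the codes of their tops. Since two points can be compared at the
level where they split, the order is defined by an arithmetical formula, and no transfinite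
recursion (not available in `ACA₀`) is needed.

It is a well order because all pieces of a class with top `t` have smaller rank than `t`: for a
nonempty set `A`, a top of minimal rank among those whose class meets `A` in an initial segment of
`A` must be the least element of `A` (`RankedTree.exists_minimal`). A class with a top is convex,
with the top as its greatest element, so neighbourhoods of non-isolated points are governed by
intervals to their left. An isolated point may however be a limit in this order. Hence the points
are sent into the lexicographic product with the numbers, `x` going to `(x, 1)` if isolated and to
`(x, 0)` otherwise. -/

namespace SOA

/-! ### Arithmetical predicates and functions of tuples -/

open FirstOrder

/-- A type of tuples of numbers. -/
class Ctx (𝓜 : outParam SOStructure.{u}) (Γ : Type u) where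
  idx : Type
  fin : Finite idx
  coords : Γ ≃ (idx → 𝓜.Num)

/-- The type of empty tuples. -/
structure Pt (𝓜 : SOStructure.{u}) : Type u where

instance (𝓜 : SOStructure.{u}) : Ctx 𝓜 (Pt 𝓜) where
  idx := Empty
  fin := inferInstance
  coords := ⟨fun _ i => i.elim, fun _ => ⟨⟩, fun _ => rfl, fun _ => funext fun i => i.elim⟩

instance {𝓜 : SOStructure.{u}} {Γ : Type u} [Ctx 𝓜 Γ] : Ctx 𝓜 (Γ × 𝓜.Num) where
  idx := Ctx.idx Γ ⊕ Fin 1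
  fin := by have := Ctx.fin (Γ := Γ); infer_instance
  coords := (Equiv.prodCongr Ctx.coords (Equiv.funUnique (Fin 1) 𝓜.Num).symm).trans
    (Equiv.sumArrowEquivProdArrow _ _ _).symm

variable {𝓜 : SOStructure.{u}} {Γ Δ Ξ : Type u} [Ctx 𝓜 Γ] [Ctx 𝓜 Δ] [Ctx 𝓜 Ξ]

/-- Arithmetical predicates of tuples, with parameters. -/
class DefPred (P : Γ → Prop) : Prop where
  definable : (Set.univ : Set 𝓜.Num).Definable (arithLang 𝓜)
    {v : Ctx.idx Γ → 𝓜.Num | P (Ctx.coords.symm v)}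

/-- Maps which only permute, copy or omit coordinates. -/
class DefMap (m : Γ → Δ) : Prop where
  exists_comp : ∃ r : Ctx.idx Δ → Ctx.idx Γ, ∀ c, Ctx.coords (m c) = Ctx.coords c ∘ r

/-- Functions with an arithmetical graph. -/
class DefFun (f : Γ → 𝓜.Num) : Prop where
  graph : DefPred fun p : Γ × 𝓜.Num => f p.1 = p.2

theorem DefMap.id : DefMap fun c : Γ => c := ⟨⟨_root_.id, fun _ => rfl⟩⟩

theorem DefMap.fst {m : Γ → Δ × 𝓜.Num} (h : DefMap m) : DefMap fun c => (m c).1 := by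
  obtain ⟨r, hr⟩ := h.exists_comp
  exact ⟨⟨fun i => r (Sum.inl i), fun c => funext fun i => congrFun (hr c) (Sum.inl i)⟩⟩

theorem DefMap.weaken {m : Γ → Δ} (h : DefMap m) :
    DefMap fun p : Γ × 𝓜.Num => (m p.1, p.2) := by
  obtain ⟨r, hr⟩ := h.exists_comp
  refine ⟨⟨Sum.map r _root_.id, fun p => funext fun i => ?_⟩⟩
  rcases i with i | i
  · exact congrFun (hr p.1) i
  · rfl

theorem DefPred.comp {P : Δ → Prop} {m : Γ → Δ} (hP : DefPred P) (hm : DefMap m) :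
    DefPred fun c => P (m c) := by
  obtain ⟨r, hr⟩ := hm.exists_comp
  have := Set.Definable.preimage_comp r hP.definable
  constructor
  convert this using 1
  ext v
  have h := hr (Ctx.coords.symm v)
  rw [Equiv.apply_symm_apply] at h
  simp only [Set.mem_ofPred_eq, Set.mem_preimage]
  rw [← h, Equiv.symm_apply_apply]

theorem DefFun.comp {f : Δ → 𝓜.Num} {m : Γ → Δ} (hf : DefFun f) (hm : DefMap m) :
    DefFun fun c => f (m c) :=
  ⟨DefPred.comp hf.graph hm.weaken⟩

theorem DefPred.and {P Q : Γ → Prop} (hP : DefPred P) (hQ : DefPred Q) :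
    DefPred fun c => P c ∧ Q c :=
  ⟨Set.Definable.inter hP.definable hQ.definable⟩

theorem DefPred.not {P : Γ → Prop} (hP : DefPred P) : DefPred fun c => ¬ P c :=
  ⟨Set.Definable.compl hP.definable⟩

theorem DefPred.or {P Q : Γ → Prop} (hP : DefPred P) (hQ : DefPred Q) :
    DefPred fun c => P c ∨ Q c :=
  ⟨Set.Definable.union hP.definable hQ.definable⟩

theorem DefPred.imp {P Q : Γ → Prop} (hP : DefPred P) (hQ : DefPred Q) :
    DefPred fun c => P c → Q c := by
  simpa only [imp_iff_not_or] using hP.not.or hQ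

theorem DefPred.iff {P Q : Γ → Prop} (hP : DefPred P) (hQ : DefPred Q) :
    DefPred fun c => (P c ↔ Q c) := by
  simpa only [iff_iff_implies_and_implies] using (hP.imp hQ).and (hQ.imp hP)

/-- A proposition without number variables has a fixed truth value, so it defines the empty or the
full set however complicated it is. -/
theorem DefPred.const (P : Prop) : DefPred fun _ : Γ => P := by
  by_cases h : P
  · exact ⟨by simp [h]⟩
  · exact ⟨by simp [h]⟩

theorem DefPred.ex {P : Γ → 𝓜.Num → Prop} (hP : DefPred fun p : Γ × 𝓜.Num => P p.1 p.2) :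
    DefPred fun c => ∃ x, P c x := by
  have := Set.Definable.image_comp_sumInl_fin 1 hP.definable
  constructor
  convert this using 1
  ext v
  simp only [Set.mem_ofPred_eq, Set.mem_image]
  constructor
  · rintro ⟨x, hx⟩
    refine ⟨Ctx.coords (Ctx.coords.symm v, x), ?_, ?_⟩
    · change P (Ctx.coords.symm (Ctx.coords (Ctx.coords.symm v, x))).1
        (Ctx.coords.symm (Ctx.coords (Ctx.coords.symm v, x))).2
      rw [Equiv.symm_apply_apply]
      exact hx
    · exact Ctx.coords.apply_symm_apply v
  · rintro ⟨w, hw, rfl⟩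
    exact ⟨_, hw⟩

theorem DefPred.all {P : Γ → 𝓜.Num → Prop} (hP : DefPred fun p : Γ × 𝓜.Num => P p.1 p.2) :
    DefPred fun c => ∀ x, P c x := by
  simpa only [not_exists, not_not] using (DefPred.ex (P := fun c x => ¬ P c x) hP.not).not

/-- A function with arithmetical graph is eliminated in favour of its value: `∃ x, f c = x ∧ P c x`.
-/
theorem DefPred.subst {P : Γ → 𝓜.Num → Prop} {f : Γ → 𝓜.Num}
    (hP : DefPred fun p : Γ × 𝓜.Num => P p.1 p.2) (hf : DefFun f) : DefPred fun c => P c (f c) := by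
  have := DefPred.ex (P := fun c x => f c = x ∧ P c x) (DefPred.and hf.graph hP)
  simpa only [exists_eq_left'] using this

/-- The first-order language of arithmetic with all numbers and sets as parameters. -/
abbrev paramLang (𝓜 : SOStructure.{u}) := (arithLang 𝓜)[[(Set.univ : Set 𝓜.Num)]]

theorem DefPred.of_formula (φ : (paramLang 𝓜).Formula (Ctx.idx Γ))
    {P : Γ → Prop} (h : ∀ c, φ.Realize (Ctx.coords c) ↔ P c) : DefPred P := by
  refine ⟨⟨φ, ?_⟩⟩
  ext v
  have := h (Ctx.coords.symm v)
  rw [Equiv.apply_symm_apply] at this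
  exact this.symm

/-- The membership predicate of a set of the structure. -/
def memSymbol (A : 𝓜.Sets) : (paramLang 𝓜).Relations 1 := Sum.inl (ArithRel.mem A)

/-- The order relation. -/
def ltSymbol (𝓜 : SOStructure.{u}) : (paramLang 𝓜).Relations 2 := Sum.inl ArithRel.lt

/-- The symbol for addition. -/
def addSymbol (𝓜 : SOStructure.{u}) : (paramLang 𝓜).Functions 2 := Sum.inl ArithFunc.add

/-- The symbol for multiplication. -/
def mulSymbol (𝓜 : SOStructure.{u}) : (paramLang 𝓜).Functions 2 := Sum.inl ArithFunc.mul

/-- The term for a coordinate of a tuple. -/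
def coordVar (i : Ctx.idx Γ) : (paramLang 𝓜).Term (Ctx.idx Γ) := Language.Term.var i

theorem DefPred.memLast {A : Set 𝓜.Num} (hA : A ∈ 𝓜.Sets) :
    DefPred fun p : Γ × 𝓜.Num => p.2 ∈ A :=
  DefPred.of_formula
    (Language.Relations.formula₁ (memSymbol ⟨A, hA⟩) (coordVar (Γ := Γ × 𝓜.Num) (Sum.inr 0)))
    fun c => Language.Formula.realize_rel₁ (R := memSymbol ⟨A, hA⟩) (v := Ctx.coords c)

theorem DefPred.ltLast : DefPred fun p : (Γ × 𝓜.Num) × 𝓜.Num => 𝓜.lt p.1.2 p.2 :=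
  DefPred.of_formula
    (Language.Relations.formula₂ (ltSymbol 𝓜)
      (coordVar (Γ := (Γ × 𝓜.Num) × 𝓜.Num) (Sum.inl (Sum.inr 0))) (coordVar (Sum.inr 0)))
    fun c => Language.Formula.realize_rel₂ (R := ltSymbol 𝓜) (v := Ctx.coords c)

theorem DefPred.eqLast : DefPred fun p : (Γ × 𝓜.Num) × 𝓜.Num => p.1.2 = p.2 :=
  DefPred.of_formula
    (Language.Term.equal
      (coordVar (Γ := (Γ × 𝓜.Num) × 𝓜.Num) (Sum.inl (Sum.inr 0))) (coordVar (Sum.inr 0)))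
    fun c => Language.Formula.realize_equal (x := Ctx.coords c)

theorem DefPred.addLast :
    DefPred fun p : ((Γ × 𝓜.Num) × 𝓜.Num) × 𝓜.Num => 𝓜.add p.1.1.2 p.1.2 = p.2 :=
  DefPred.of_formula
    (Language.Term.equal
      (Language.Functions.apply₂ (addSymbol 𝓜)
        (coordVar (Γ := ((Γ × 𝓜.Num) × 𝓜.Num) × 𝓜.Num) (Sum.inl (Sum.inl (Sum.inr 0))))
        (coordVar (Sum.inl (Sum.inr 0)))) (coordVar (Sum.inr 0)))
    fun c => Language.Formula.realize_equal (x := Ctx.coords c)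

theorem DefPred.mulLast :
    DefPred fun p : ((Γ × 𝓜.Num) × 𝓜.Num) × 𝓜.Num => 𝓜.mul p.1.1.2 p.1.2 = p.2 :=
  DefPred.of_formula
    (Language.Term.equal
      (Language.Functions.apply₂ (mulSymbol 𝓜)
        (coordVar (Γ := ((Γ × 𝓜.Num) × 𝓜.Num) × 𝓜.Num) (Sum.inl (Sum.inl (Sum.inr 0))))
        (coordVar (Sum.inl (Sum.inr 0)))) (coordVar (Sum.inr 0)))
    fun c => Language.Formula.realize_equal (x := Ctx.coords c)

theorem DefPred.constLast (a : 𝓜.Num) : DefPred fun p : Γ × 𝓜.Num => a = p.2 :=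
  DefPred.of_formula
    (Language.Term.equal
      (Language.Constants.term ((arithLang 𝓜).con (⟨a, trivial⟩ : (Set.univ : Set 𝓜.Num))))
      (coordVar (Γ := Γ × 𝓜.Num) (Sum.inr 0)))
    fun c => Language.Formula.realize_equal (x := Ctx.coords c)

theorem DefFun.const (a : 𝓜.Num) : DefFun fun _ : Γ => a := ⟨DefPred.constLast a⟩

theorem DefFun.last {m : Γ → Δ × 𝓜.Num} (hm : DefMap m) : DefFun fun c => (m c).2 :=
  DefFun.comp (f := Prod.snd) ⟨DefPred.eqLast (Γ := Δ)⟩ hm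

theorem DefFun.weaken {f : Γ → 𝓜.Num} (hf : DefFun f) : DefFun fun p : Γ × 𝓜.Num => f p.1 :=
  hf.comp DefMap.id.fst

theorem DefPred.mem {A : Set 𝓜.Num} (hA : A ∈ 𝓜.Sets) {f : Γ → 𝓜.Num} (hf : DefFun f) :
    DefPred fun c => f c ∈ A :=
  DefPred.subst (P := fun _ x => x ∈ A) (DefPred.memLast hA) hf

theorem DefPred.lt {f g : Γ → 𝓜.Num} (hf : DefFun f) (hg : DefFun g) :
    DefPred fun c => 𝓜.lt (f c) (g c) :=
  DefPred.subst (P := fun c y => 𝓜.lt (f c) y)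
    (DefPred.subst (P := fun (c : Γ × 𝓜.Num) x => 𝓜.lt x c.2)
      (DefPred.subst (P := fun (c : (Γ × 𝓜.Num) × 𝓜.Num) y => 𝓜.lt c.2 y) DefPred.ltLast
        (DefFun.last DefMap.id.fst)) hf.weaken) hg

theorem DefMap.pair {m : Γ → Δ} {n : Γ → Ξ × 𝓜.Num} (hm : DefMap m) (hn : DefMap n) :
    DefMap fun c => (m c, (n c).2) := by
  obtain ⟨r, hr⟩ := hm.exists_comp
  obtain ⟨t, ht⟩ := hn.exists_comp
  refine ⟨⟨Sum.elim r fun _ => t (Sum.inr 0), fun p => funext fun i => ?_⟩⟩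
  rcases i with i | i
  · exact congrFun (hr p) i
  · exact congrFun (ht p) (Sum.inr 0)

theorem DefPred.eq {f g : Γ → 𝓜.Num} (hf : DefFun f) (hg : DefFun g) :
    DefPred fun c => f c = g c :=
  DefPred.subst (P := fun c y => f c = y) hf.graph hg

theorem DefFun.lift₂ {F : 𝓜.Num → 𝓜.Num → 𝓜.Num}
    (hF : ∀ {Γ : Type u} [Ctx 𝓜 Γ],
      DefPred fun p : ((Γ × 𝓜.Num) × 𝓜.Num) × 𝓜.Num => F p.1.1.2 p.1.2 = p.2)
    {f g : Γ → 𝓜.Num} (hf : DefFun f) (hg : DefFun g) : DefFun fun c => F (f c) (g c) := by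
  have h₁ : DefPred fun q : ((Γ × 𝓜.Num) × 𝓜.Num) × 𝓜.Num => F q.1.2 q.2 = q.1.1.2 :=
    hF.comp (((DefMap.id.fst.fst.fst.pair DefMap.id.fst).pair DefMap.id).pair DefMap.id.fst.fst)
  have h₂ : DefPred fun p : (Γ × 𝓜.Num) × 𝓜.Num => F p.2 (g p.1.1) = p.1.2 :=
    DefPred.subst (P := fun (p : (Γ × 𝓜.Num) × 𝓜.Num) y => F p.2 y = p.1.2) h₁ hg.weaken.weaken
  exact ⟨DefPred.subst (P := fun (p : Γ × 𝓜.Num) x => F x (g p.1) = p.2) h₂ hf.weaken⟩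

theorem DefFun.sum {f g : Γ → 𝓜.Num} (hf : DefFun f) (hg : DefFun g) :
    DefFun fun c => 𝓜.add (f c) (g c) :=
  DefFun.lift₂ DefPred.addLast hf hg

theorem DefFun.product {f g : Γ → 𝓜.Num} (hf : DefFun f) (hg : DefFun g) :
    DefFun fun c => 𝓜.mul (f c) (g c) :=
  DefFun.lift₂ DefPred.mulLast hf hg

theorem DefFun.code {f g : Γ → 𝓜.Num} (hf : DefFun f) (hg : DefFun g) :
    DefFun fun c => 𝓜.pair (f c) (g c) :=
  ((hf.sum hg).product (hf.sum hg)).sum hf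

theorem DefPred.mem_sets (h : 𝓜.IsModelACA0) {P : 𝓜.Num → Prop}
    (hP : DefPred fun p : Pt 𝓜 × 𝓜.Num => P p.2) : {x | P x} ∈ 𝓜.Sets := by
  apply h.arithmetical_comprehension
  have := Set.Definable.preimage_comp (fun _ => 0 : Ctx.idx (Pt 𝓜 × 𝓜.Num) → Fin 1) hP.definable
  unfold Set.Definable₁
  convert this using 1
  rfl

/-- Transfers definability from the two-variable context to an arbitrary one, so that a relation has
to be checked only once. -/
theorem DefPred.comp₂ {R : 𝓜.Num → 𝓜.Num → Prop}
    (hR : DefPred fun p : (Pt 𝓜 × 𝓜.Num) × 𝓜.Num => R p.1.2 p.2)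
    {f g : Γ → 𝓜.Num} (hf : DefFun f) (hg : DefFun g) : DefPred fun c => R (f c) (g c) := by
  have h₀ : DefMap fun p : (Γ × 𝓜.Num) × 𝓜.Num => ((((⟨⟩ : Pt 𝓜), p.1.2), p.2) :
      (Pt 𝓜 × 𝓜.Num) × 𝓜.Num) :=
    DefMap.pair (DefMap.pair ⟨⟨Empty.elim, fun _ => funext fun i => i.elim⟩⟩ DefMap.id.fst) DefMap.id
  have h₁ : DefPred fun p : Γ × 𝓜.Num => R p.2 (g p.1) :=
    DefPred.subst (P := fun (p : Γ × 𝓜.Num) y => R p.2 y) (DefPred.comp hR h₀) hg.weaken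
  exact DefPred.subst (P := fun c x => R x (g c)) h₁ hf

/-! ### Definability by instance search -/

section Instances

instance {P Q : Γ → Prop} [hP : DefPred P] [hQ : DefPred Q] : DefPred fun c => P c ∧ Q c := hP.and hQ

instance {P Q : Γ → Prop} [hP : DefPred P] [hQ : DefPred Q] : DefPred fun c => P c ∨ Q c := hP.or hQ

instance {P Q : Γ → Prop} [hP : DefPred P] [hQ : DefPred Q] : DefPred fun c => P c → Q c :=
  hP.imp hQ

instance {P Q : Γ → Prop} [hP : DefPred P] [hQ : DefPred Q] : DefPred fun c => (P c ↔ Q c) :=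
  hP.iff hQ

instance {P : Γ → Prop} [hP : DefPred P] : DefPred fun c => ¬ P c := hP.not

instance {P : Γ → 𝓜.Num → Prop} [hP : DefPred fun p : Γ × 𝓜.Num => P p.1 p.2] :
    DefPred fun c => ∃ x, P c x := hP.ex

instance {P : Γ → 𝓜.Num → Prop} [hP : DefPred fun p : Γ × 𝓜.Num => P p.1 p.2] :
    DefPred fun c => ∀ x, P c x := hP.all

instance {f g : Γ → 𝓜.Num} [hf : DefFun f] [hg : DefFun g] : DefPred fun c => f c = g c :=
  DefPred.eq hf hg

instance {f g : Γ → 𝓜.Num} [hf : DefFun f] [hg : DefFun g] : DefPred fun c => f c ≠ g c :=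
  (DefPred.eq hf hg).not

instance {f g : Γ → 𝓜.Num} [hf : DefFun f] [hg : DefFun g] : DefPred fun c => 𝓜.lt (f c) (g c) :=
  DefPred.lt hf hg

instance {A : Set 𝓜.Num} [hA : Fact (A ∈ 𝓜.Sets)] {f : Γ → 𝓜.Num} [hf : DefFun f] :
    DefPred fun c => f c ∈ A := DefPred.mem hA.out hf

instance {A : Set 𝓜.Num} [hA : Fact (A ∈ 𝓜.Sets)] {f : Γ → 𝓜.Num} [hf : DefFun f] :
    DefPred fun c => f c ∉ A := (DefPred.mem hA.out hf).not

instance {A : Set 𝓜.Num} [hA : Fact (A ∈ 𝓜.Sets)] {f g : Γ → 𝓜.Num} [hf : DefFun f]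
    [hg : DefFun g] : DefPred fun c => f c ∈ 𝓜.sec A (g c) := DefPred.mem hA.out (hf.code hg)

instance {P : Prop} : DefPred fun _ : Γ => P := DefPred.const P

instance {f g : Γ → 𝓜.Num} [hf : DefFun f] [hg : DefFun g] : DefFun fun c => 𝓜.add (f c) (g c) :=
  hf.sum hg

instance {f g : Γ → 𝓜.Num} [hf : DefFun f] [hg : DefFun g] : DefFun fun c => 𝓜.mul (f c) (g c) :=
  hf.product hg

instance {f g : Γ → 𝓜.Num} [hf : DefFun f] [hg : DefFun g] : DefFun fun c => 𝓜.pair (f c) (g c) :=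
  hf.code hg

instance (priority := low) {f : Δ → 𝓜.Num} [hf : DefFun f] {m : Γ → Δ} [hm : DefMap m] :
    DefFun fun c => f (m c) := hf.comp hm

instance (priority := low) {P : Δ → Prop} [hP : DefPred P] {m : Γ → Δ} [hm : DefMap m] :
    DefPred fun c => P (m c) := hP.comp hm

instance : DefFun (Prod.snd : Γ × 𝓜.Num → 𝓜.Num) := DefFun.last DefMap.id

instance {m : Γ → Δ × 𝓜.Num} [hm : DefMap m] : DefFun fun c => (m c).2 := DefFun.last hm

instance {m : Γ → Δ × 𝓜.Num} [hm : DefMap m] : DefMap fun c => (m c).1 := hm.fst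

instance : DefMap (Prod.fst : Γ × 𝓜.Num → Γ) := DefMap.id.fst

instance : DefMap (fun c : Γ => c) := DefMap.id

instance (a : 𝓜.Num) : DefFun (fun _ : Γ => a) := DefFun.const a

end Instances

/-- Arithmetical binary relations. -/
class DefRel (R : 𝓜.Num → 𝓜.Num → Prop) : Prop where
  definable : DefPred fun p : (Pt 𝓜 × 𝓜.Num) × 𝓜.Num => R p.1.2 p.2

instance {R : 𝓜.Num → 𝓜.Num → Prop} [hR : DefRel R] {f g : Γ → 𝓜.Num} [hf : DefFun f]
    [hg : DefFun g] : DefPred fun c => R (f c) (g c) :=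
  DefPred.comp₂ hR.definable hf hg

/-- Arithmetical properties of numbers. -/
class DefSet (P : 𝓜.Num → Prop) : Prop where
  definable : DefPred fun p : Pt 𝓜 × 𝓜.Num => P p.2

instance {P : 𝓜.Num → Prop} [hP : DefSet P] {f : Γ → 𝓜.Num} [hf : DefFun f] :
    DefPred fun c => P (f c) :=
  DefPred.comp₂ (R := fun x _ => P x)
    (DefPred.comp (m := Prod.fst) hP.definable DefMap.id.fst) hf hf

theorem DefMap.empty : DefMap fun _ : Γ => (⟨⟩ : Pt 𝓜) :=
  ⟨⟨Empty.elim, fun _ => funext fun i => i.elim⟩⟩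

/-- Arithmetical relations of four numbers. -/
class DefRel₄ (R : 𝓜.Num → 𝓜.Num → 𝓜.Num → 𝓜.Num → Prop) : Prop where
  definable : DefPred fun p : (((Pt 𝓜 × 𝓜.Num) × 𝓜.Num) × 𝓜.Num) × 𝓜.Num =>
    R p.1.1.1.2 p.1.1.2 p.1.2 p.2

instance {R : 𝓜.Num → 𝓜.Num → 𝓜.Num → 𝓜.Num → Prop} [hR : DefRel₄ R] {f₁ f₂ f₃ f₄ : Γ → 𝓜.Num}
    [hf₁ : DefFun f₁] [hf₂ : DefFun f₂] [hf₃ : DefFun f₃] [hf₄ : DefFun f₄] :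
    DefPred fun c => R (f₁ c) (f₂ c) (f₃ c) (f₄ c) := by
  have h₀ := DefPred.comp (Γ := (((Γ × 𝓜.Num) × 𝓜.Num) × 𝓜.Num) × 𝓜.Num) hR.definable
    ((((DefMap.empty.pair DefMap.id.fst.fst.fst).pair DefMap.id.fst.fst).pair
      DefMap.id.fst).pair DefMap.id)
  have h₁ := DefPred.subst (P := fun (p : ((Γ × 𝓜.Num) × 𝓜.Num) × 𝓜.Num) y =>
    R p.1.1.2 p.1.2 p.2 y) h₀ hf₄.weaken.weaken.weaken
  have h₂ := DefPred.subst (P := fun (p : (Γ × 𝓜.Num) × 𝓜.Num) y =>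
    R p.1.2 p.2 y (f₄ p.1.1)) h₁ hf₃.weaken.weaken
  have h₃ := DefPred.subst (P := fun (p : Γ × 𝓜.Num) y => R p.2 y (f₃ p.1) (f₄ p.1)) h₂ hf₂.weaken
  exact DefPred.subst (P := fun p y => R y (f₂ p) (f₃ p) (f₄ p)) h₃ hf₁

/-- Binary operations with an arithmetical graph. -/
class DefOp (F : 𝓜.Num → 𝓜.Num → 𝓜.Num) : Prop where
  graph : DefPred fun p : ((Pt 𝓜 × 𝓜.Num) × 𝓜.Num) × 𝓜.Num => F p.1.1.2 p.1.2 = p.2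

instance {F : 𝓜.Num → 𝓜.Num → 𝓜.Num} [hF : DefOp F] {f g : Γ → 𝓜.Num} [hf : DefFun f]
    [hg : DefFun g] : DefFun fun c => F (f c) (g c) :=
  DefFun.lift₂ (DefPred.comp hF.graph
    (((DefMap.empty.pair DefMap.id.fst.fst).pair DefMap.id.fst).pair DefMap.id)) hf hg

end SOA

/-! ### Ordered semiring arithmetic and pairing in a model -/

namespace SOA

variable {𝓜 : SOStructure.{u}} {Γ : Type u} [Ctx 𝓜 Γ]

instance : Zero 𝓜.Num := ⟨𝓜.zero⟩
instance : One 𝓜.Num := ⟨𝓜.one⟩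
instance : Add 𝓜.Num := ⟨𝓜.add⟩
instance : Mul 𝓜.Num := ⟨𝓜.mul⟩

instance {f g : Γ → 𝓜.Num} [hf : DefFun f] [hg : DefFun g] : DefFun fun c => f c + g c :=
  hf.sum hg

instance {f g : Γ → 𝓜.Num} [hf : DefFun f] [hg : DefFun g] : DefFun fun c => f c * g c :=
  hf.product hg

namespace Num

variable [h𝓜 : Fact 𝓜.IsModelACA0]

/-- Set induction plus comprehension yields induction for arithmetical predicates only; the instance
argument guards against external predicates, for which it can fail in a nonstandard model. -/
theorem ind {P : 𝓜.Num → Prop} [hP : DefPred fun p : Pt 𝓜 × 𝓜.Num => P p.2]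
    (zero : P 0) (succ : ∀ n, P n → P (n + 1)) (n : 𝓜.Num) : P n :=
  h𝓜.out.induction _ (hP.mem_sets h𝓜.out) zero succ n

theorem add_zero' (m : 𝓜.Num) : m + 0 = m := h𝓜.out.add_zero m
theorem add_succ' (m n : 𝓜.Num) : m + (n + 1) = m + n + 1 := h𝓜.out.add_succ m n
theorem mul_zero' (m : 𝓜.Num) : m * 0 = 0 := h𝓜.out.mul_zero m
theorem mul_succ' (m n : 𝓜.Num) : m * (n + 1) = m * n + m := h𝓜.out.mul_succ m n
theorem succ_ne_zero' (n : 𝓜.Num) : n + 1 ≠ 0 := h𝓜.out.add_one_ne_zero n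
theorem succ_inj' {m n : 𝓜.Num} (h : m + 1 = n + 1) : m = n := h𝓜.out.add_one_inj m n h

theorem zero_add' (n : 𝓜.Num) : 0 + n = n :=
  ind (P := fun n => 0 + n = n) (add_zero' 0) (fun n hn => by rw [add_succ', hn]) n

theorem succ_add' (m n : 𝓜.Num) : m + 1 + n = m + n + 1 :=
  ind (P := fun n => m + 1 + n = m + n + 1) (by rw [add_zero', add_zero'])
    (fun n hn => by rw [add_succ', hn, add_succ']) n

theorem add_comm' (m n : 𝓜.Num) : m + n = n + m :=
  ind (P := fun n => m + n = n + m) (by rw [add_zero', zero_add'])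
    (fun n hn => by rw [add_succ', hn, succ_add']) n

theorem add_assoc' (a b c : 𝓜.Num) : a + b + c = a + (b + c) :=
  ind (P := fun c => a + b + c = a + (b + c)) (by rw [add_zero', add_zero'])
    (fun n hn => by rw [add_succ', hn, add_succ', add_succ']) c

theorem zero_mul' (n : 𝓜.Num) : 0 * n = 0 :=
  ind (P := fun n => 0 * n = 0) (mul_zero' 0) (fun n hn => by rw [mul_succ', hn, add_zero']) n

theorem succ_mul' (m n : 𝓜.Num) : (m + 1) * n = m * n + n :=
  ind (P := fun n => (m + 1) * n = m * n + n) (by rw [mul_zero', mul_zero', add_zero'])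
    (fun n hn => by
      rw [mul_succ', hn, mul_succ', add_succ', add_succ', add_assoc' (m * n) n m, add_comm' n m,
        ← add_assoc']) n

theorem mul_comm' (m n : 𝓜.Num) : m * n = n * m :=
  ind (P := fun n => m * n = n * m) (by rw [mul_zero', zero_mul'])
    (fun n hn => by rw [mul_succ', hn, succ_mul']) n

theorem mul_add' (a b c : 𝓜.Num) : a * (b + c) = a * b + a * c :=
  ind (P := fun c => a * (b + c) = a * b + a * c) (by rw [add_zero', mul_zero', add_zero'])
    (fun n hn => by rw [add_succ', mul_succ', hn, mul_succ', add_assoc']) c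

theorem mul_assoc' (a b c : 𝓜.Num) : a * b * c = a * (b * c) :=
  ind (P := fun c => a * b * c = a * (b * c)) (by rw [mul_zero', mul_zero', mul_zero'])
    (fun n hn => by rw [mul_succ', hn, mul_succ', mul_add']) c

theorem mul_one' (m : 𝓜.Num) : m * 1 = m := by
  rw [← zero_add' (1 : 𝓜.Num), mul_succ', mul_zero', zero_add']

instance : CommSemiring 𝓜.Num where
  add_assoc := add_assoc'
  zero_add := zero_add'
  add_zero := add_zero'
  add_comm := add_comm'
  mul_assoc := mul_assoc'
  one_mul m := by rw [mul_comm', mul_one']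
  mul_one := mul_one'
  left_distrib := mul_add'
  right_distrib a b c := by rw [mul_comm', mul_add', mul_comm' c a, mul_comm' c b]
  zero_mul := zero_mul'
  mul_zero := mul_zero'
  mul_comm := mul_comm'
  nsmul := nsmulRec
  npow := npowRec

theorem add_right_cancel_num {a b c : 𝓜.Num} (h : a + c = b + c) : a = b := by
  revert h
  refine ind (P := fun c => a + c = b + c → a = b) (fun h => ?_) (fun n hn h => hn ?_) c
  · rwa [add_zero, add_zero] at h
  · rw [← add_assoc, ← add_assoc] at h
    exact succ_inj' h

instance : IsCancelAdd 𝓜.Num where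
  add_right_cancel _ _ _ h := add_right_cancel_num h
  add_left_cancel a b c h := add_right_cancel_num (by
    have h : a + b = a + c := h
    rwa [add_comm a b, add_comm a c] at h)

theorem eq_zero_or_succ (n : 𝓜.Num) : n = 0 ∨ ∃ m, n = m + 1 :=
  ind (P := fun n => n = 0 ∨ ∃ m, n = m + 1) (Or.inl rfl) (fun n _ => Or.inr ⟨n, rfl⟩) n

theorem add_eq_zero_left {a b : 𝓜.Num} (h : a + b = 0) : b = 0 := by
  obtain rfl | ⟨d, rfl⟩ := eq_zero_or_succ b
  · rfl
  · exact absurd (by rw [← h, add_assoc]) (succ_ne_zero' (a + d))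

theorem lt_iff_exists (a b : 𝓜.Num) : 𝓜.lt a b ↔ ∃ d, a + (d + 1) = b := by
  refine ind (P := fun b => 𝓜.lt a b ↔ ∃ d, a + (d + 1) = b) ?_ (fun n hn => ?_) b
  · refine iff_of_false (h𝓜.out.not_lt_zero a) ?_
    rintro ⟨d, hd⟩
    exact succ_ne_zero' d (add_eq_zero_left hd)
  · refine (h𝓜.out.lt_succ a n).trans ?_
    rw [hn]
    constructor
    · rintro (⟨d, rfl⟩ | rfl)
      · exact ⟨d + 1, by ring⟩
      · exact ⟨0, by ring⟩
    · rintro ⟨d, hd⟩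
      have hd : a + d = n := succ_inj' (by rw [← hd]; ring)
      obtain rfl | ⟨e, rfl⟩ := eq_zero_or_succ d
      · exact Or.inr (by rw [← hd, add_zero])
      · exact Or.inl ⟨e, hd⟩

open Classical in
noncomputable instance : LinearOrder 𝓜.Num where
  le a b := ∃ d, a + d = b
  lt := 𝓜.lt
  le_refl a := ⟨0, add_zero a⟩
  le_trans a b c := by
    rintro ⟨d, rfl⟩ ⟨e, rfl⟩
    exact ⟨d + e, by ring⟩
  le_antisymm a b := by
    rintro ⟨d, rfl⟩ ⟨e, he⟩
    have : d + e = 0 := add_left_cancel (a := a) (by rw [← add_assoc, he, add_zero])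
    rw [add_comm] at this
    rw [add_eq_zero_left this, add_zero]
  lt_iff_le_not_ge a b := by
    rw [lt_iff_exists]
    constructor
    · rintro ⟨d, rfl⟩
      refine ⟨⟨d + 1, rfl⟩, ?_⟩
      rintro ⟨e, he⟩
      have : e + d + 1 = 0 := add_left_cancel (a := a) (by
        rw [add_zero]; nth_rw 2 [← he]; ring)
      exact succ_ne_zero' _ this
    · rintro ⟨⟨d, rfl⟩, h⟩
      obtain rfl | ⟨e, rfl⟩ := eq_zero_or_succ d
      · exact absurd ⟨0, by ring⟩ h
      · exact ⟨e, rfl⟩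
  le_total a b := by
    refine ind (P := fun b => (∃ d, a + d = b) ∨ ∃ d, b + d = a) (Or.inr ⟨a, zero_add a⟩) ?_ b
    rintro n (⟨d, rfl⟩ | ⟨d, rfl⟩)
    · exact Or.inl ⟨d + 1, by ring⟩
    · obtain rfl | ⟨e, rfl⟩ := eq_zero_or_succ d
      · exact Or.inl ⟨1, by ring⟩
      · exact Or.inr ⟨e, by ring⟩
  toDecidableLE := Classical.decRel _

theorem le_iff_exists_add' {a b : 𝓜.Num} : a ≤ b ↔ ∃ d, a + d = b := Iff.rfl

instance : CanonicallyOrderedAdd 𝓜.Num where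
  exists_add_of_le h := by
    obtain ⟨d, rfl⟩ := h
    exact ⟨d, rfl⟩
  le_add_self a b := ⟨b, add_comm a b⟩
  le_self_add a b := ⟨b, rfl⟩

instance {f g : Γ → 𝓜.Num} [hf : DefFun f] [hg : DefFun g] : DefPred fun c => f c < g c :=
  DefPred.lt hf hg

instance {f g : Γ → 𝓜.Num} [hf : DefFun f] [hg : DefFun g] : DefPred fun c => f c ≤ g c := by
  simp only [le_iff_exists_add']
  infer_instance

theorem lt_succ_iff {a b : 𝓜.Num} : a < b + 1 ↔ a ≤ b := by
  refine (h𝓜.out.lt_succ a b).trans ?_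
  rw [le_iff_lt_or_eq]
  rfl

theorem succ_le_iff' {a b : 𝓜.Num} : a + 1 ≤ b ↔ a < b := by
  rw [← not_lt, lt_succ_iff, not_le]

theorem strong_ind {P : 𝓜.Num → Prop} [hP : DefPred fun p : Pt 𝓜 × 𝓜.Num => P p.2]
    (step : ∀ n, (∀ m < n, P m) → P n) (n : 𝓜.Num) : P n := by
  have : DefSet P := ⟨hP⟩
  refine step n (ind (P := fun n => ∀ m, m < n → P m) (fun m hm => ?_) (fun k hk m hm => ?_) n)
  · exact absurd hm not_lt_zero
  · rw [lt_succ_iff] at hm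
    rcases hm.lt_or_eq with hm | rfl
    · exact hk m hm
    · exact step m hk

theorem exists_least {P : 𝓜.Num → Prop} [hP : DefPred fun p : Pt 𝓜 × 𝓜.Num => P p.2]
    (h : ∃ n, P n) : ∃ n, P n ∧ ∀ m < n, ¬ P m := by
  have : DefSet P := ⟨hP⟩
  by_contra! hc
  obtain ⟨n, hn⟩ := h
  refine strong_ind (P := fun n => ¬ P n) (fun n hn hp => ?_) n hn
  obtain ⟨m, hm, hpm⟩ := hc n hp
  exact hn m hm hpm

omit h𝓜 in
theorem pair_eq (i j : 𝓜.Num) : 𝓜.pair i j = (i + j) * (i + j) + i := rfl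

/-- With `s = i + j`, the code `s² + i` lies between `s²` and `s² + s < (s + 1)²`, so the sum can be
read off from the code. -/
theorem pair_lt_aux {i j k l : 𝓜.Num} (h : i + j < k + l) : 𝓜.pair i j < 𝓜.pair k l := by
  obtain ⟨d, hd⟩ := succ_le_iff'.2 h
  rw [pair_eq, pair_eq, ← hd]
  refine succ_le_iff'.1 ⟨(i + j) + j + (i + j) * d + d * (i + j) + d + d + d * d + k, ?_⟩
  ring

theorem pair_inj {i j k l : 𝓜.Num} (h : 𝓜.pair i j = 𝓜.pair k l) : i = k ∧ j = l := by
  have hs : i + j = k + l := by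
    rcases lt_trichotomy (i + j) (k + l) with h' | h' | h'
    · exact absurd h (pair_lt_aux h').ne
    · exact h'
    · exact absurd h (pair_lt_aux h').ne'
  have hi : i = k := by
    rw [pair_eq, pair_eq, hs] at h
    exact add_left_cancel h
  subst hi
  exact ⟨rfl, add_left_cancel hs⟩

theorem le_mul_self (a : 𝓜.Num) : a ≤ a * a := by
  obtain rfl | ⟨d, rfl⟩ := eq_zero_or_succ a
  · exact ⟨0, by ring⟩
  · exact ⟨d * d + d, by ring⟩

end Num

end SOA

/-! ### Coding of finite sets by Gödel's beta function -/

namespace SOA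

variable {𝓜 : SOStructure.{u}} {Γ : Type u} [Ctx 𝓜 Γ] [h𝓜 : Fact 𝓜.IsModelACA0]

namespace Num

instance {f g : Γ → 𝓜.Num} [hf : DefFun f] [hg : DefFun g] : DefPred fun c => f c ∣ g c := by
  simp only [dvd_def]
  infer_instance

/-- The moduli of Gödel's beta function. -/
def modulus (b i : 𝓜.Num) : 𝓜.Num := 1 + (i + 1) * b

instance {f g : Γ → 𝓜.Num} [hf : DefFun f] [hg : DefFun g] :
    DefFun fun c => modulus (f c) (g c) := by
  unfold modulus
  infer_instance

theorem dvd_of_dvd_add {x a u : 𝓜.Num} (hu : x ∣ u) (h : x ∣ a + u) : x ∣ a := by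
  obtain ⟨s, rfl⟩ := hu
  obtain ⟨t, ht⟩ := h
  rcases le_total s t with ⟨d, rfl⟩ | ⟨d, rfl⟩
  · exact ⟨d, add_right_cancel (b := x * s) (by rw [ht]; ring)⟩
  · have : a + x * d = 0 := add_right_cancel (b := x * t) <| calc
      a + x * d + x * t = a + x * (t + d) := by ring
      _ = 0 + x * t := by rw [ht, zero_add]
    rw [add_comm] at this
    rw [add_eq_zero_left this]
    exact dvd_zero x

/-- The moduli are coprime: `(k + 1) * modulus b i - (i + 1) * modulus b k = k - i`, the absolute
value of which divides `b`, while `b` is invertible modulo `modulus b i`. The identities below are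
this Bézout relation with the negative terms moved to the other side. -/
theorem dvd_of_dvd_mul_modulus {b n a i k : 𝓜.Num} (hb : ∀ d < n, (d + 1) ∣ b) (hi : i < n)
    (hk : k < n) (hik : i ≠ k) (h : modulus b i ∣ a * modulus b k) : modulus b i ∣ a := by
  rcases lt_or_gt_of_ne hik with hlt | hlt
  · obtain ⟨e, rfl⟩ := (lt_iff_exists i k).1 hlt
    obtain ⟨q, hq⟩ := hb e (lt_of_le_of_lt ⟨i + 1, by ring⟩ hk)
    refine dvd_of_dvd_add (u := (i + 1) * q * (i + (e + 1) + 1) * a * modulus b i)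
      (dvd_mul_left _ _) ?_
    have : a + (i + 1) * q * (i + (e + 1) + 1) * a * modulus b i =
        a * modulus b i + (i + 1) * (i + 1) * q * (a * modulus b (i + (e + 1))) := by
      unfold modulus
      rw [hq]
      ring
    rw [this]
    exact dvd_add (dvd_mul_left _ _) (h.mul_left _)
  · obtain ⟨e, rfl⟩ := (lt_iff_exists k i).1 hlt
    obtain ⟨q, hq⟩ := hb e (lt_of_le_of_lt ⟨k + 1, by ring⟩ hi)
    refine dvd_of_dvd_add (h.mul_left ((k + (e + 1) + 1) * (k + (e + 1) + 1) * q)) ?_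
    have : a + (k + (e + 1) + 1) * (k + (e + 1) + 1) * q * (a * modulus b k) =
        a * (1 + (k + (e + 1) + 1) * q * (k + 1)) * modulus b (k + (e + 1)) := by
      unfold modulus
      rw [hq]
      ring
    rw [this]
    exact dvd_mul_left _ _

/-- The factorial, built by induction since exponentiation and products are not yet coded. -/
theorem exists_common_multiple (n : 𝓜.Num) : ∃ b, b ≠ 0 ∧ ∀ d, d < n → (d + 1) ∣ b := by
  refine ind (P := fun n => ∃ b, b ≠ 0 ∧ ∀ d, d < n → (d + 1) ∣ b)
    ⟨1, ?_, fun d hd => absurd hd not_lt_zero⟩ ?_ n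
  · rw [← zero_add (1 : 𝓜.Num)]
    exact succ_ne_zero' 0
  · rintro n ⟨b, hb, h⟩
    refine ⟨b * (n + 1), fun h0 => hb (add_eq_zero_left (a := b * n) ?_), fun d hd => ?_⟩
    · rw [← h0]
      ring
    · rcases (lt_succ_iff.1 hd).lt_or_eq with hd | rfl
      · exact (h d hd).mul_right _
      · exact dvd_mul_left _ _

theorem not_modulus_dvd_one {b i : 𝓜.Num} (hb : b ≠ 0) : ¬ modulus b i ∣ 1 := by
  rintro ⟨c, hc⟩
  obtain rfl | ⟨d, rfl⟩ := eq_zero_or_succ c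
  · rw [mul_zero, ← zero_add (1 : 𝓜.Num)] at hc
    exact succ_ne_zero' 0 hc
  · refine hb (add_eq_zero_left (a := d + i * b * (d + 1) + b * d) ?_)
    refine add_left_cancel (a := 1) <| calc
      1 + (d + i * b * (d + 1) + b * d + b) = modulus b i * (d + 1) := by unfold modulus; ring
      _ = 1 + 0 := by rw [← hc, add_zero]

/-- `y` is an element of the finite set with code `c`. -/
def Elem (y c : 𝓜.Num) : Prop :=
  ∃ a b n, c = 𝓜.pair (𝓜.pair a b) n ∧ y < n ∧ modulus b y ∣ a

instance {f g : Γ → 𝓜.Num} [hf : DefFun f] [hg : DefFun g] :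
    DefPred fun c => Elem (f c) (g c) := by
  unfold Elem
  infer_instance

theorem right_le_pair (i j : 𝓜.Num) : j ≤ 𝓜.pair i j :=
  calc j ≤ i + j := ⟨i, add_comm j i⟩
    _ ≤ (i + j) * (i + j) := le_mul_self _
    _ ≤ _ := ⟨i, rfl⟩

theorem Elem.lt {y c : 𝓜.Num} (h : Elem y c) : y < c := by
  obtain ⟨a, b, n, rfl, hy, -⟩ := h
  exact hy.trans_le (right_le_pair _ n)

/-- The code is the product of the moduli of the elements; by coprimality no other modulus below `n`
divides it. -/
theorem exists_code {P : 𝓜.Num → Prop} [hP : DefPred fun p : Pt 𝓜 × 𝓜.Num => P p.2] (n : 𝓜.Num)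
    (hn : ∀ y, P y → y < n) : ∃ c, ∀ y, Elem y c ↔ P y := by
  have : DefSet P := ⟨hP⟩
  obtain ⟨b, hb, hdvd⟩ := exists_common_multiple n
  -- The product over the elements below `k`, starting from the empty product `1`, which no modulus
  -- divides because `b ≠ 0`.
  have key : ∀ k, ∃ a, ∀ i, i < n → (modulus b i ∣ a ↔ i < k ∧ P i) := by
    refine ind ⟨1, fun i _ => iff_of_false (not_modulus_dvd_one hb)
      fun h => absurd h.1 not_lt_zero⟩ ?_
    rintro k ⟨a, ha⟩
    by_cases hk : P k
    · refine ⟨a * modulus b k, fun i hi => ?_⟩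
      by_cases hik : i = k
      · subst hik
        exact iff_of_true (dvd_mul_left _ _) ⟨lt_succ_iff.2 le_rfl, hk⟩
      · have h₁ : modulus b i ∣ a * modulus b k ↔ modulus b i ∣ a :=
          ⟨dvd_of_dvd_mul_modulus hdvd hi (hn k hk) hik, fun h => h.mul_right _⟩
        rw [h₁, ha i hi, lt_succ_iff, le_iff_lt_or_eq, or_iff_left hik]
    · refine ⟨a, fun i hi => ?_⟩
      rw [ha i hi, lt_succ_iff, le_iff_lt_or_eq]
      constructor
      · exact fun h => ⟨Or.inl h.1, h.2⟩
      · rintro ⟨h | rfl, h'⟩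
        · exact ⟨h, h'⟩
        · exact absurd h' hk
  obtain ⟨a, ha⟩ := key n
  refine ⟨𝓜.pair (𝓜.pair a b) n, fun y => ⟨?_, fun hy => ⟨a, b, n, rfl, hn y hy, ?_⟩⟩⟩
  · rintro ⟨a', b', n', h, hy, hd⟩
    obtain ⟨h', rfl⟩ := pair_inj h
    obtain ⟨rfl, rfl⟩ := pair_inj h'
    exact ((ha y hy).1 hd).2
  · exact (ha y (hn y hy)).2 ⟨hn y hy, hy⟩

/-! ### Course-of-values recursion with least choices -/

section Recursion

variable (S : 𝓜.Num → 𝓜.Num → 𝓜.Num → 𝓜.Num → Prop)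

/-- `v` is the least number in relation `S` to `a, c, k`. -/
def LeastStep (a c k v : 𝓜.Num) : Prop := S a c k v ∧ ∀ w, w < v → ¬ S a c k w

/-- `c` codes the values below `n` of the function defined by recursion from `S` with parameter
`a`. -/
def Run (a c n : 𝓜.Num) : Prop := ∀ k, k < n → ∀ v, Elem (𝓜.pair k v) c ↔ LeastStep S a c k v

variable {S} [hS : DefRel₄ S]

instance {f₁ f₂ f₃ f₄ : Γ → 𝓜.Num} [DefFun f₁] [DefFun f₂] [DefFun f₃] [DefFun f₄] :
    DefPred fun c => LeastStep S (f₁ c) (f₂ c) (f₃ c) (f₄ c) := by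
  unfold LeastStep
  infer_instance

instance {f₁ f₂ f₃ : Γ → 𝓜.Num} [DefFun f₁] [DefFun f₂] [DefFun f₃] :
    DefPred fun c => Run S (f₁ c) (f₂ c) (f₃ c) := by
  unfold Run
  infer_instance

theorem exists_leastStep {a c k : 𝓜.Num} (h : ∃ v, S a c k v) : ∃ v, LeastStep S a c k v :=
  exists_least (P := fun v => S a c k v) h

omit hS in
theorem LeastStep.unique {a c k v w : 𝓜.Num} (hv : LeastStep S a c k v)
    (hw : LeastStep S a c k w) : v = w := by
  rcases lt_trichotomy v w with h | h | h
  · exact absurd hv.1 (hw.2 v h)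
  · exact h
  · exact absurd hw.1 (hv.2 w h)

omit hS in
theorem LeastStep.congr (hext : ∀ a c c' k v, (∀ l < k, ∀ w, Elem (𝓜.pair l w) c ↔
      Elem (𝓜.pair l w) c') → S a c k v → S a c' k v) {a c c' k : 𝓜.Num}
    (h : ∀ l < k, ∀ w, Elem (𝓜.pair l w) c ↔ Elem (𝓜.pair l w) c') (v : 𝓜.Num) :
    LeastStep S a c k v ↔ LeastStep S a c' k v := by
  have h' : ∀ v, S a c k v ↔ S a c' k v := fun v =>
    ⟨hext a c c' k v h, hext a c' c k v fun l hl w => (h l hl w).symm⟩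
  simp only [LeastStep, h']

theorem exists_run (hext : ∀ a c c' k v, (∀ l < k, ∀ w, Elem (𝓜.pair l w) c ↔
      Elem (𝓜.pair l w) c') → S a c k v → S a c' k v)
    (htot : ∀ a c k, ∃ v, S a c k v) (a n : 𝓜.Num) : ∃ c, Run S a c n := by
  refine ind (P := fun n => ∃ c, Run S a c n) ⟨0, fun k hk => absurd hk not_lt_zero⟩ ?_ n
  rintro n ⟨c, hc⟩
  obtain ⟨w, hw⟩ := exists_leastStep (htot a c n)
  obtain ⟨c', hc'⟩ := exists_code
    (P := fun y => (∃ l v, l < n ∧ y = 𝓜.pair l v ∧ Elem y c) ∨ y = 𝓜.pair n w)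
    (c + 𝓜.pair n w + 1) (by
      rintro y (⟨l, v, -, -, hy⟩ | rfl)
      · exact lt_succ_iff.2 (hy.lt.le.trans ⟨_, rfl⟩)
      · exact lt_succ_iff.2 ⟨c, add_comm _ _⟩)
  have hlt : ∀ l < n, ∀ v, Elem (𝓜.pair l v) c ↔ Elem (𝓜.pair l v) c' := by
    intro l hl v
    rw [hc']
    constructor
    · exact fun h => Or.inl ⟨l, v, hl, rfl, h⟩
    · rintro (⟨_, _, -, -, h⟩ | h)
      · exact h
      · exact absurd (pair_inj h).1 hl.ne
  refine ⟨c', fun k hk v => ?_⟩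
  rcases (lt_succ_iff.1 hk).lt_or_eq with hk | rfl
  · rw [← LeastStep.congr hext fun l hl => hlt l (hl.trans hk), ← hlt k hk]
    exact hc k hk v
  · rw [← LeastStep.congr hext hlt, hc']
    constructor
    · rintro (⟨l, u, hl, h, -⟩ | h)
      · exact absurd (pair_inj h).1 hl.ne'
      · rwa [(pair_inj h).2]
    · exact fun h => Or.inr (by rw [hw.unique h])

omit hS in
theorem Run.agree (hext : ∀ a c c' k v, (∀ l < k, ∀ w, Elem (𝓜.pair l w) c ↔
      Elem (𝓜.pair l w) c') → S a c k v → S a c' k v) {a c c' n n' : 𝓜.Num}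
    (h : Run S a c n) (h' : Run S a c' n') (k : 𝓜.Num) :
    k < n → k < n' → ∀ v, Elem (𝓜.pair k v) c ↔ Elem (𝓜.pair k v) c' := by
  refine strong_ind (P := fun k => k < n → k < n' → ∀ v, Elem (𝓜.pair k v) c ↔
    Elem (𝓜.pair k v) c') (fun k ih hk hk' v => ?_) k
  rw [h k hk, h' k hk']
  exact LeastStep.congr hext (fun l hl => ih l hl (hl.trans hk) (hl.trans hk')) v

/-- Taking the least admissible value at each step makes all coded runs agree, provided that `S`
sees the code `c` only through the values below `k`. The parameter `a` lets one recursion serve a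
whole family of constructions. -/
theorem exists_recursion (hext : ∀ a c c' k v, (∀ l < k, ∀ w, Elem (𝓜.pair l w) c ↔
      Elem (𝓜.pair l w) c') → S a c k v → S a c' k v)
    (htot : ∀ a c k, ∃ v, S a c k v) : ∃ h : 𝓜.Num → 𝓜.Num → 𝓜.Num, DefOp h ∧
      ∀ a k, ∃ c, (∀ l ≤ k, ∀ w, Elem (𝓜.pair l w) c ↔ h a l = w) ∧ S a c k (h a k) := by
  have hex : ∀ a k, ∃ v, ∃ c, Run S a c (k + 1) ∧ Elem (𝓜.pair k v) c := by
    intro a k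
    obtain ⟨c, hc⟩ := exists_run hext htot a (k + 1)
    obtain ⟨v, hv⟩ := exists_leastStep (htot a c k)
    exact ⟨v, c, hc, (hc k (lt_succ_iff.2 le_rfl) v).2 hv⟩
  choose h hh using hex
  -- Although `h` comes from external choice, uniqueness of runs shows that its graph is
  -- arithmetical.
  have huniq : ∀ a k v, h a k = v ↔ ∃ c, Run S a c (k + 1) ∧ Elem (𝓜.pair k v) c := by
    refine fun a k v => ⟨fun e => e ▸ hh a k, ?_⟩
    rintro ⟨c, hc, hv⟩
    obtain ⟨c', hc', hv'⟩ := hh a k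
    have hk : k < k + 1 := lt_succ_iff.2 le_rfl
    rw [hc.agree hext hc' k hk hk, hc' k hk] at hv
    rw [hc' k hk] at hv'
    exact hv'.unique hv
  refine ⟨h, ⟨?_⟩, fun a k => ?_⟩
  · simp only [huniq]
    infer_instance
  · obtain ⟨c, hc, hv⟩ := hh a k
    refine ⟨c, fun l hl w => ?_, ((hc k (lt_succ_iff.2 le_rfl) _).1 hv).1⟩
    have hl : l < k + 1 := lt_succ_iff.2 hl
    rw [huniq]
    constructor
    · exact fun hw => ⟨c, fun j hj => hc j (hj.trans_le (succ_le_iff'.2 hl)), hw⟩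
    · rintro ⟨c', hc', hw⟩
      exact (hc'.agree hext hc l (lt_succ_iff.2 le_rfl) hl w).1 hw

end Recursion

end Num

end SOA

set_option synthInstance.maxHeartbeats 400000
set_option synthInstance.maxSize 2000

/-! ### Separation of closed sets by clopen sets -/

namespace SOA

variable {𝓜 : SOStructure.{u}} {Γ : Type u} [Ctx 𝓜 Γ]

namespace SOStructure.CSCS

variable (X : 𝓜.CSCS)

instance : Fact (X.pts ∈ 𝓜.Sets) := ⟨X.pts_mem⟩

instance {f g : Γ → 𝓜.Num} [hf : DefFun f] [hg : DefFun g] : DefPred fun c => f c ∈ X.U (g c) :=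
  DefPred.mem X.base_mem (hf.code hg)

instance {f g : Γ → 𝓜.Num} [hf : DefFun f] [hg : DefFun g] :
    DefPred fun c => f c ∈ X.cl (X.U (g c)) := by
  change DefPred fun c => f c ∈ X.pts ∧ ∀ i, f c ∈ X.U i → ∃ z, z ∈ X.U (g c) ∧ z ∈ X.U i
  infer_instance

/-- The property `P` defines a closed subset of the space. -/
def ClosedProp (P : 𝓜.Num → Prop) : Prop :=
  ∀ x ∈ X.pts, ¬ P x → ∃ n, x ∈ X.U n ∧ ∀ y ∈ X.U n, ¬ P y

variable {X}

theorem mem_pts {x i : 𝓜.Num} (h : x ∈ X.U i) : x ∈ X.pts := X.base_subset i h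

theorem mem_cl {x i : 𝓜.Num} (h : x ∈ X.U i) : x ∈ X.cl (X.U i) := ⟨mem_pts h, fun _ hj => ⟨x, h, hj⟩⟩

theorem exists_inter {x i j : 𝓜.Num} (hi : x ∈ X.U i) (hj : x ∈ X.U j) :
    ∃ m, x ∈ X.U m ∧ ∀ y ∈ X.U m, y ∈ X.U i ∧ y ∈ X.U j := by
  obtain ⟨m, hm, -⟩ := X.inter_function x (mem_pts hi) i j
  obtain ⟨h₁, h₂⟩ := X.inter_spec x (mem_pts hi) i j m hm hi hj
  exact ⟨m, h₁, fun y hy => h₂ hy⟩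

theorem ClosedProp.or {P Q : 𝓜.Num → Prop} (hP : X.ClosedProp P) (hQ : X.ClosedProp Q) :
    X.ClosedProp fun x => P x ∨ Q x := by
  intro x hx h
  obtain ⟨i, hi, hiP⟩ := hP x hx fun h' => h (Or.inl h')
  obtain ⟨j, hj, hjQ⟩ := hQ x hx fun h' => h (Or.inr h')
  obtain ⟨m, hm, hmij⟩ := exists_inter hi hj
  exact ⟨m, hm, fun y hy h' => h'.elim (hiP y (hmij y hy).1) (hjQ y (hmij y hy).2)⟩

theorem closedProp_cl (i : 𝓜.Num) : X.ClosedProp fun x => x ∈ X.cl (X.U i) := by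
  intro x hx h
  by_contra! hc
  refine h ⟨hx, fun n hn => ?_⟩
  obtain ⟨y, hy, hy'⟩ := hc n hn
  exact hy'.2 n hy

theorem closedProp_compl (i : 𝓜.Num) : X.ClosedProp fun x => x ∈ X.pts ∧ x ∉ X.U i := by
  intro x hx h
  exact ⟨i, by_contra fun h' => h ⟨hx, h'⟩, fun y hy h' => h'.2 hy⟩

theorem ClosedProp.exists_cl (hT3 : X.IsT3) {P : 𝓜.Num → Prop} (hP : X.ClosedProp P) {x : 𝓜.Num}
    (hx : x ∈ X.pts) (h : ¬ P x) : ∃ m, x ∈ X.U m ∧ ∀ y ∈ X.cl (X.U m), ¬ P y := by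
  obtain ⟨n, hn, hnP⟩ := hP x hx h
  obtain ⟨m, hm, hmn⟩ := hT3.2 x hx n hn
  exact ⟨m, hm, fun y hy => hnP y (hmn hy)⟩

variable [h𝓜 : Fact 𝓜.IsModelACA0]

/-- The closed set `H` enlarged by the closures of the neighbourhoods which `V` assigns to the side
`s` at the points below `k`. -/
def Side (X : 𝓜.CSCS) (H : 𝓜.Num → Prop) (V : 𝓜.Num → 𝓜.Num → Prop) (s k x : 𝓜.Num) : Prop :=
  H x ∨ ∃ l, l < k ∧ l ∈ X.pts ∧ ∃ m, V l (𝓜.pair m s) ∧ x ∈ X.cl (X.U m)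

/-- `w` codes a neighbourhood of `k` and a side, such that the closure of the neighbourhood does
not meet the other side. -/
def Fits (X : 𝓜.CSCS) (F G : 𝓜.Num → Prop) (k w : 𝓜.Num) : Prop :=
  ∃ m s, w = 𝓜.pair m s ∧ k ∈ X.U m ∧
    ((s = 0 ∧ ∀ x, x ∈ X.cl (X.U m) → ¬ G x) ∨ (s = 1 ∧ ∀ x, x ∈ X.cl (X.U m) → ¬ F x))

/-- The condition on the choice `v` for the point `k` when `c` codes the previous choices. -/
def SepStep (X : 𝓜.CSCS) (F G : 𝓜.Num → 𝓜.Num → Prop) (a c k v : 𝓜.Num) : Prop :=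
  (∃ w, X.Fits (X.Side (F a) (fun l w => Num.Elem (𝓜.pair l w) c) 0 k)
    (X.Side (G a) (fun l w => Num.Elem (𝓜.pair l w) c) 1 k) k w) →
  X.Fits (X.Side (F a) (fun l w => Num.Elem (𝓜.pair l w) c) 0 k)
    (X.Side (G a) (fun l w => Num.Elem (𝓜.pair l w) c) 1 k) k v

instance {F G : 𝓜.Num → 𝓜.Num → Prop} [DefRel F] [DefRel G] : DefRel₄ (X.SepStep F G) := by
  constructor
  unfold SepStep Fits Side
  beta_reduce
  infer_instance

/-- The sides at stage `k` depend only on earlier choices, as the recursion requires. -/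
theorem side_congr {H : 𝓜.Num → Prop} {V V' : 𝓜.Num → 𝓜.Num → Prop} {s k : 𝓜.Num}
    (h : ∀ l < k, ∀ w, V l w ↔ V' l w) : X.Side H V s k = X.Side H V' s k := by
  funext x
  refine propext (or_congr Iff.rfl (exists_congr fun l => and_congr_right fun hl => ?_))
  simp only [h l hl]

theorem side_succ {H : 𝓜.Num → Prop} {V : 𝓜.Num → 𝓜.Num → Prop} {s k x : 𝓜.Num} :
    X.Side H V s (k + 1) x ↔
      X.Side H V s k x ∨ (k ∈ X.pts ∧ ∃ m, V k (𝓜.pair m s) ∧ x ∈ X.cl (X.U m)) := by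
  constructor
  · rintro (h | ⟨l, hl, h⟩)
    · exact Or.inl (Or.inl h)
    · rcases (Num.lt_succ_iff.1 hl).lt_or_eq with hl | rfl
      · exact Or.inl (Or.inr ⟨l, hl, h⟩)
      · exact Or.inr h
  · rintro ((h | ⟨l, hl, h⟩) | h)
    · exact Or.inl h
    · exact Or.inr ⟨l, hl.trans (Num.lt_succ_iff.2 le_rfl), h⟩
    · exact Or.inr ⟨k, Num.lt_succ_iff.2 le_rfl, h⟩

-- A point lies in at most one of the two sides; regularity gives a neighbourhood whose closure
-- misses a side that does not contain it.
omit h𝓜 in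
theorem exists_fits (hT3 : X.IsT3) {F G : 𝓜.Num → Prop} (hF : X.ClosedProp F)
    (hG : X.ClosedProp G) (hFG : ∀ x, F x → ¬ G x) {k : 𝓜.Num} (hk : k ∈ X.pts) :
    ∃ w, X.Fits F G k w := by
  by_cases h : G k
  · obtain ⟨m, hm, hmF⟩ := hF.exists_cl hT3 hk fun h' => hFG k h' h
    exact ⟨_, m, 1, rfl, hm, Or.inr ⟨rfl, hmF⟩⟩
  · obtain ⟨m, hm, hmG⟩ := hG.exists_cl hT3 hk h
    exact ⟨_, m, 0, rfl, hm, Or.inl ⟨rfl, hmG⟩⟩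

theorem zero_ne_one_num : (0 : 𝓜.Num) ≠ 1 := by
  rw [← zero_add (1 : 𝓜.Num)]
  exact (Num.succ_ne_zero' 0).symm

/-- If the choices `V` are made well below `k`, both sides are closed and disjoint. -/
theorem sides_disjoint_closed (hT3 : X.IsT3) {F G : 𝓜.Num → Prop} [DefSet F] [DefSet G]
    (hF : X.ClosedProp F) (hG : X.ClosedProp G) (hFG : ∀ x, F x → ¬ G x)
    {V : 𝓜.Num → 𝓜.Num → Prop} [DefRel V] (hV : ∀ l v w, V l v → V l w → v = w)
    (hstep : ∀ k, (∃ w, X.Fits (X.Side F V 0 k) (X.Side G V 1 k) k w) →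
      ∃ w, V k w ∧ X.Fits (X.Side F V 0 k) (X.Side G V 1 k) k w) (k : 𝓜.Num) :
    (∀ x, X.Side F V 0 k x → ¬ X.Side G V 1 k x) ∧ X.ClosedProp (X.Side F V 0 k) ∧
      X.ClosedProp (X.Side G V 1 k) := by
  -- Closedness and disjointness quantify over numbers only, so the invariant is open to induction.
  have hdef : DefPred fun p : Pt 𝓜 × 𝓜.Num => (∀ x, X.Side F V 0 p.2 x → ¬ X.Side G V 1 p.2 x) ∧
      X.ClosedProp (X.Side F V 0 p.2) ∧ X.ClosedProp (X.Side G V 1 p.2) := by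
    unfold Side ClosedProp
    beta_reduce
    infer_instance
  have hzero : ∀ (H : 𝓜.Num → Prop) (s : 𝓜.Num), X.Side H V s 0 = H := by
    intro H s
    funext x
    refine propext ⟨?_, Or.inl⟩
    rintro (h | ⟨l, hl, -⟩)
    · exact h
    · exact absurd hl not_lt_zero
  refine Num.ind (P := fun k => (∀ x, X.Side F V 0 k x → ¬ X.Side G V 1 k x) ∧
    X.ClosedProp (X.Side F V 0 k) ∧ X.ClosedProp (X.Side G V 1 k)) ?_ ?_ k
  · rw [hzero, hzero]
    exact ⟨hFG, hF, hG⟩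
  · rintro k ⟨hd, hFk, hGk⟩
    by_cases hk : k ∈ X.pts
    · obtain ⟨w, hw, m, s, rfl, -, hs⟩ := hstep k (exists_fits hT3 hFk hGk hd hk)
      have hsucc : ∀ (H : 𝓜.Num → Prop) (t : 𝓜.Num), X.Side H V t (k + 1) =
          fun x => X.Side H V t k x ∨ (s = t ∧ x ∈ X.cl (X.U m)) := by
        intro H t
        funext x
        rw [side_succ]
        refine propext (or_congr Iff.rfl ⟨?_, ?_⟩)
        · rintro ⟨-, m', hm', hx⟩
          obtain ⟨rfl, rfl⟩ := Num.pair_inj (hV k _ _ hw hm')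
          exact ⟨rfl, hx⟩
        · rintro ⟨rfl, hx⟩
          exact ⟨hk, m, hw, hx⟩
      have hcl : ∀ (H : 𝓜.Num → Prop) (t : 𝓜.Num), X.ClosedProp (X.Side H V t k) →
          X.ClosedProp (X.Side H V t (k + 1)) := by
        intro H t hH
        rw [hsucc]
        by_cases hst : s = t
        · simpa [hst] using hH.or (closedProp_cl m)
        · simpa [hst] using hH
      refine ⟨fun x => ?_, hcl F 0 hFk, hcl G 1 hGk⟩
      rw [hsucc, hsucc]
      rcases hs with ⟨rfl, hs⟩ | ⟨rfl, hs⟩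
      · rintro (h | ⟨-, h⟩) (h' | ⟨h', -⟩)
        · exact hd x h h'
        · exact zero_ne_one_num h'
        · exact hs x h h'
        · exact zero_ne_one_num h'
      · rintro (h | ⟨h, -⟩) (h' | ⟨-, h'⟩)
        · exact hd x h h'
        · exact hs x h' h
        · exact zero_ne_one_num h.symm
        · exact zero_ne_one_num h.symm
    · have hsucc : ∀ (H : 𝓜.Num → Prop) (t : 𝓜.Num), X.Side H V t (k + 1) = X.Side H V t k := by
        intro H t
        funext x
        rw [side_succ]
        exact propext (or_iff_left fun h => hk h.1)
      rw [hsucc, hsucc]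
      exact ⟨hd, hFk, hGk⟩

/-- The property `P` defines a clopen subset of the space. -/
def ClopenProp (X : 𝓜.CSCS) (P : 𝓜.Num → Prop) : Prop :=
  ∀ x ∈ X.pts, ∃ j, x ∈ X.U j ∧ ∀ y ∈ X.U j, (P y ↔ P x)

/-- The clopen set resulting from the choices `V`. -/
def chosen (X : 𝓜.CSCS) (V : 𝓜.Num → 𝓜.Num → Prop) (s x : 𝓜.Num) : Prop :=
  ∃ k m, k ∈ X.pts ∧ V k (𝓜.pair m s) ∧ x ∈ X.U m

/-- Each point lies in its own chosen neighbourhood, so the two chosen open sets cover the space.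
They are disjoint because the later of two neighbourhoods on different sides avoids the opposite
side, which already contains the closure of the earlier one. Hence both are clopen, and each avoids
the closed set that starts the other side. -/
theorem chosen_separates (hT3 : X.IsT3) {F G : 𝓜.Num → Prop} [DefSet F] [DefSet G]
    (hF : X.ClosedProp F) (hG : X.ClosedProp G) (hFG : ∀ x, F x → ¬ G x)
    {V : 𝓜.Num → 𝓜.Num → Prop} [DefRel V] (hV : ∀ l v w, V l v → V l w → v = w)
    (hstep : ∀ k, (∃ w, X.Fits (X.Side F V 0 k) (X.Side G V 1 k) k w) →
      ∃ w, V k w ∧ X.Fits (X.Side F V 0 k) (X.Side G V 1 k) k w) :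
    X.ClopenProp (X.chosen V 0) ∧ (∀ x ∈ X.pts, F x → X.chosen V 0 x) ∧
      ∀ x, X.chosen V 0 x → ¬ G x := by
  have hinv := sides_disjoint_closed hT3 hF hG hFG hV hstep
  have hfit : ∀ k ∈ X.pts, ∃ w, V k w ∧ X.Fits (X.Side F V 0 k) (X.Side G V 1 k) k w := fun k hk =>
    hstep k (exists_fits hT3 (hinv k).2.1 (hinv k).2.2 (hinv k).1 hk)
  have hcover : ∀ x ∈ X.pts, X.chosen V 0 x ∨ X.chosen V 1 x := by
    intro x hx
    obtain ⟨w, hw, m, s, rfl, hm, ⟨rfl, -⟩ | ⟨rfl, -⟩⟩ := hfit x hx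
    · exact Or.inl ⟨x, m, hx, hw, hm⟩
    · exact Or.inr ⟨x, m, hx, hw, hm⟩
  have havoid₀ : ∀ k ∈ X.pts, ∀ m, V k (𝓜.pair m 0) → ∀ x ∈ X.U m, ¬ X.Side G V 1 k x := by
    intro k hk m hm x hx
    obtain ⟨w, hw, m', s, rfl, -, h⟩ := hfit k hk
    obtain ⟨rfl, rfl⟩ := Num.pair_inj (hV k _ _ hm hw)
    rcases h with ⟨-, h⟩ | ⟨h, -⟩
    · exact h x (mem_cl hx)
    · exact absurd h zero_ne_one_num
  have havoid₁ : ∀ k ∈ X.pts, ∀ m, V k (𝓜.pair m 1) → ∀ x ∈ X.U m, ¬ X.Side F V 0 k x := by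
    intro k hk m hm x hx
    obtain ⟨w, hw, m', s, rfl, -, h⟩ := hfit k hk
    obtain ⟨rfl, rfl⟩ := Num.pair_inj (hV k _ _ hm hw)
    rcases h with ⟨h, -⟩ | ⟨-, h⟩
    · exact absurd h zero_ne_one_num.symm
    · exact h x (mem_cl hx)
  have hdisj : ∀ x, X.chosen V 0 x → ¬ X.chosen V 1 x := by
    rintro x ⟨k, m, hk, hm, hx⟩ ⟨l, n, hl, hn, hx'⟩
    rcases lt_trichotomy k l with h | rfl | h
    · exact havoid₁ l hl n hn x hx' (Or.inr ⟨k, h, hk, m, hm, mem_cl hx⟩)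
    · exact zero_ne_one_num (Num.pair_inj (hV k _ _ hm hn)).2
    · exact havoid₀ k hk m hm x hx (Or.inr ⟨l, h, hl, n, hn, mem_cl hx'⟩)
  refine ⟨fun x hx => ?_, fun x hx hxF => (hcover x hx).resolve_right ?_, ?_⟩
  · rcases hcover x hx with h | h
    · obtain ⟨k, m, hk, hm, hxm⟩ := h
      exact ⟨m, hxm, fun y hy => iff_of_true ⟨k, m, hk, hm, hy⟩ ⟨k, m, hk, hm, hxm⟩⟩
    · have hx₀ : ¬ X.chosen V 0 x := fun h' => hdisj x h' h
      obtain ⟨k, m, hk, hm, hxm⟩ := h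
      exact ⟨m, hxm, fun y hy => iff_of_false (fun h' => hdisj y h' ⟨k, m, hk, hm, hy⟩) hx₀⟩
  · rintro ⟨k, m, hk, hm, hxm⟩
    exact havoid₁ k hk m hm x hxm (Or.inl hxF)
  · rintro x ⟨k, m, hk, hm, hxm⟩ hxG
    exact havoid₀ k hk m hm x hxm (Or.inl hxG)

/-- Arithmetical families of pairs of disjoint closed sets are uniformly separated by clopen
sets. -/
theorem exists_clopen_separation (hT3 : X.IsT3) (F G : 𝓜.Num → 𝓜.Num → Prop) [DefRel F] [DefRel G] :
    ∃ C : 𝓜.Num → 𝓜.Num → Prop, DefRel C ∧ ∀ a, X.ClosedProp (F a) → X.ClosedProp (G a) →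
      (∀ x, F a x → ¬ G a x) →
      X.ClopenProp (C a) ∧ (∀ x ∈ X.pts, F a x → C a x) ∧ ∀ x, C a x → ¬ G a x := by
  -- The recursion has to be total for every parameter and code. `SepStep` is an implication, so
  -- where no fitting choice exists the value `0` satisfies it vacuously.
  obtain ⟨h, hdef, hh⟩ := Num.exists_recursion (S := X.SepStep F G) (by
    intro a c c' k v hcc' hS
    unfold SepStep at hS ⊢
    rwa [side_congr hcc', side_congr hcc'] at hS) (by
    intro a c k
    by_cases hw : ∃ w, X.Fits (X.Side (F a) (fun l w => Num.Elem (𝓜.pair l w) c) 0 k)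
      (X.Side (G a) (fun l w => Num.Elem (𝓜.pair l w) c) 1 k) k w
    · obtain ⟨w, hw⟩ := hw
      exact ⟨w, fun _ => hw⟩
    · exact ⟨0, fun h => absurd h hw⟩)
  refine ⟨fun a => X.chosen (fun l w => h a l = w) 0, ⟨?_⟩, fun a hF hG hFG => ?_⟩
  · unfold chosen
    infer_instance
  · have : DefSet (F a) := ⟨by infer_instance⟩
    have : DefSet (G a) := ⟨by infer_instance⟩
    have : DefRel (fun l w => h a l = w) := ⟨by infer_instance⟩
    refine chosen_separates hT3 hF hG hFG (fun l v w hv hw => hv.symm.trans hw) fun k hk => ?_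
    refine ⟨h a k, rfl, ?_⟩
    obtain ⟨c, hc, hS⟩ := hh a k
    unfold SepStep at hS
    rw [side_congr fun l hl => hc l hl.le, side_congr fun l hl => hc l hl.le] at hS
    exact hS hk

/-- For each pair with `cl U_j ⊆ U_i`, separate `cl U_j` from the complement of `U_i`; regularity
supplies enough pairs. -/
theorem exists_clopen_basis (hT3 : X.IsT3) : ∃ B : 𝓜.Num → 𝓜.Num → Prop, DefRel B ∧
    (∀ n, X.ClopenProp fun x => B x n) ∧
    ∀ x ∈ X.pts, ∀ i, x ∈ X.U i → ∃ n, B x n ∧ ∀ y ∈ X.pts, B y n → y ∈ X.U i := by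
  let F : 𝓜.Num → 𝓜.Num → Prop := fun a x => ∃ j i, a = 𝓜.pair j i ∧ x ∈ X.cl (X.U j)
  let G : 𝓜.Num → 𝓜.Num → Prop := fun a x => ∃ j i, a = 𝓜.pair j i ∧ x ∈ X.pts ∧ x ∉ X.U i
  have : DefRel F := ⟨by infer_instance⟩
  have : DefRel G := ⟨by infer_instance⟩
  have hF : ∀ j i, F (𝓜.pair j i) = fun x => x ∈ X.cl (X.U j) := by
    intro j i
    funext x
    refine propext ⟨?_, fun h => ⟨j, i, rfl, h⟩⟩
    rintro ⟨j', i', h, hx⟩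
    obtain ⟨rfl, rfl⟩ := Num.pair_inj h
    exact hx
  have hG : ∀ j i, G (𝓜.pair j i) = fun x => x ∈ X.pts ∧ x ∉ X.U i := by
    intro j i
    funext x
    refine propext ⟨?_, fun h => ⟨j, i, rfl, h⟩⟩
    rintro ⟨j', i', h, hx⟩
    obtain ⟨rfl, rfl⟩ := Num.pair_inj h
    exact hx
  obtain ⟨C, hC, hsep⟩ := exists_clopen_separation hT3 F G
  have hsep' : ∀ j i, (∀ x, x ∈ X.cl (X.U j) → x ∈ X.U i) → _ := fun j i hji =>
    hsep (𝓜.pair j i) (by rw [hF]; exact closedProp_cl j) (by rw [hG]; exact closedProp_compl i)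
      (by rw [hF, hG]; exact fun x hx h => h.2 (hji x hx))
  -- Indices that do not code such a pair get the empty set, so that every member of the sequence is
  -- clopen.
  refine ⟨fun x n => (∃ j i, n = 𝓜.pair j i ∧ ∀ x, x ∈ X.cl (X.U j) → x ∈ X.U i) ∧ C n x,
    ⟨by infer_instance⟩, fun n => ?_, fun x hx i hi => ?_⟩
  · by_cases hn : ∃ j i, n = 𝓜.pair j i ∧ ∀ x, x ∈ X.cl (X.U j) → x ∈ X.U i
    · simp only [hn, true_and]
      obtain ⟨j, i, rfl, hji⟩ := hn
      exact (hsep' j i hji).1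
    · intro x hx
      obtain ⟨j, hj⟩ := X.cover x hx
      exact ⟨j, hj, fun y _ => by simp only [hn, false_and]⟩
  · obtain ⟨j, hj, hji⟩ := hT3.2 x hx i hi
    obtain ⟨-, h₁, h₂⟩ := hsep' j i fun x hx => hji hx
    refine ⟨𝓜.pair j i, ⟨⟨j, i, rfl, fun x hx => hji hx⟩, h₁ x hx ?_⟩, fun y hy hyB => ?_⟩
    · rw [hF]
      exact mem_cl hj
    · by_contra hyi
      refine h₂ y hyB.2 ?_
      rw [hG]
      exact ⟨hy, hyi⟩

end SOStructure.CSCS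
end SOA

/-! ### The order on the points of a ranked tree -/

namespace SOA

variable {𝓜 : SOStructure.{u}} {Γ : Type u} [Ctx 𝓜 Γ] [h𝓜 : Fact 𝓜.IsModelACA0]

/-- A set of points with a separating sequence of subsets (`B x n` means that `x` is in the `n`-th
one) and a well-founded relation of having smaller rank, such that every point has a neighbourhood
in which all other points have smaller rank. -/
structure RankedTree (𝓜 : SOStructure.{u}) [h𝓜 : Fact 𝓜.IsModelACA0] where
  pts : Set 𝓜.Num
  B : 𝓜.Num → 𝓜.Num → Prop
  below : 𝓜.Num → 𝓜.Num → Prop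
  pts_mem : pts ∈ 𝓜.Sets
  defRel_B : DefRel B
  defRel_below : DefRel below
  separates : ∀ x ∈ pts, ∀ y ∈ pts, x ≠ y → ∃ n, ¬ (B x n ↔ B y n)
  wf : ∀ A ∈ 𝓜.Sets, A ⊆ pts → A.Nonempty → ∃ t ∈ A, ∀ s ∈ A, ¬ below s t
  isTop : ∀ x ∈ pts, ∃ n, ∀ y ∈ pts, (∀ i < n, (B x i ↔ B y i)) → y ≠ x → below y x

namespace RankedTree

variable (T : RankedTree 𝓜)

instance : Fact (T.pts ∈ 𝓜.Sets) := ⟨T.pts_mem⟩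
instance : DefRel T.B := T.defRel_B
instance : DefRel T.below := T.defRel_below

/-- The points `x` and `y` belong to the same sets among the first `n` ones. -/
def E (n x y : 𝓜.Num) : Prop := ∀ i, i < n → (T.B x i ↔ T.B y i)

instance {f₁ f₂ f₃ : Γ → 𝓜.Num} [DefFun f₁] [DefFun f₂] [DefFun f₃] :
    DefPred fun c => T.E (f₁ c) (f₂ c) (f₃ c) := by
  unfold E
  infer_instance

/-- The point `t` is the point of maximal rank in the class of `x` at level `n`. -/
def Top (n x t : 𝓜.Num) : Prop :=
  t ∈ T.pts ∧ T.E n x t ∧ ∀ y, y ∈ T.pts → T.E n x y → y ≠ t → T.below y t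

instance {f₁ f₂ f₃ : Γ → 𝓜.Num} [DefFun f₁] [DefFun f₂] [DefFun f₃] :
    DefPred fun c => T.Top (f₁ c) (f₂ c) (f₃ c) := by
  unfold Top
  infer_instance

/-- `k` is the first level from `n` on at which the class of `x` has a point `t` of maximal rank. -/
def FirstAt (n k x t : 𝓜.Num) : Prop :=
  n ≤ k ∧ T.Top k x t ∧ ∀ j, n ≤ j → j < k → ∀ u, ¬ T.Top j x u

/-- The point `t` is the point of maximal rank in the largest class of `x` which has one, among
those from level `n` on. -/
def First (n x t : 𝓜.Num) : Prop := ∃ k, T.FirstAt n k x t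

instance {f₁ f₂ f₃ : Γ → 𝓜.Num} [DefFun f₁] [DefFun f₂] [DefFun f₃] :
    DefPred fun c => T.First (f₁ c) (f₂ c) (f₃ c) := by
  unfold First FirstAt
  infer_instance

/-- The points `x` and `y`, which are separated at level `n`, are in increasing order. -/
def Cmp (n x y : 𝓜.Num) : Prop :=
  (∃ t, T.Top n x t ∧ ¬ (T.B x n ↔ T.B t n) ∧ (T.B y n ↔ T.B t n)) ∨
    ((∀ t, ¬ T.Top n x t) ∧ ∃ t u, T.First n x t ∧ T.First n y u ∧ t < u)

/-- The well-ordering of the points. -/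
def Lt (x y : 𝓜.Num) : Prop :=
  x ∈ T.pts ∧ y ∈ T.pts ∧ ∃ n, T.E n x y ∧ ¬ (T.B x n ↔ T.B y n) ∧ T.Cmp n x y

instance {f₁ f₂ : Γ → 𝓜.Num} [DefFun f₁] [DefFun f₂] :
    DefPred fun c => T.Lt (f₁ c) (f₂ c) := by
  unfold Lt Cmp
  infer_instance

variable {T} {n m k x y z t u v w : 𝓜.Num}

theorem E.refl (n x : 𝓜.Num) : T.E n x x := fun _ _ => Iff.rfl

theorem E.symm (h : T.E n x y) : T.E n y x := fun i hi => (h i hi).symm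

theorem E.trans (h : T.E n x y) (h' : T.E n y z) : T.E n x z :=
  fun i hi => (h i hi).trans (h' i hi)

theorem E.mono (h : T.E n x y) (hmn : m ≤ n) : T.E m x y := fun i hi => h i (hi.trans_le hmn)

theorem E_succ : T.E (n + 1) x y ↔ T.E n x y ∧ (T.B x n ↔ T.B y n) := by
  constructor
  · exact fun h => ⟨fun i hi => h i (hi.trans (Num.lt_succ_iff.2 le_rfl)),
      h n (Num.lt_succ_iff.2 le_rfl)⟩
  · rintro ⟨h, hn⟩ i hi
    rcases (Num.lt_succ_iff.1 hi).lt_or_eq with hi | rfl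
    · exact h i hi
    · exact hn

theorem E.lt_of_not (h : T.E n x y) (hm : ¬ (T.B x m ↔ T.B y m)) : n ≤ m :=
  not_lt.1 fun h' => hm (h m h')

theorem exists_split_of_not (h : ∃ n, ¬ (T.B x n ↔ T.B y n)) :
    ∃ n, T.E n x y ∧ ¬ (T.B x n ↔ T.B y n) := by
  obtain ⟨n, hn, hmin⟩ := Num.exists_least (P := fun n => ¬ (T.B x n ↔ T.B y n)) h
  exact ⟨n, fun i hi => not_not.1 (hmin i hi), hn⟩

theorem exists_split (hx : x ∈ T.pts) (hy : y ∈ T.pts) (hxy : x ≠ y) :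
    ∃ n, T.E n x y ∧ ¬ (T.B x n ↔ T.B y n) :=
  exists_split_of_not (T.separates x hx y hy hxy)

/-- Well-foundedness applied to `{x, y}`. -/
theorem below_asymm (hx : x ∈ T.pts) (hy : y ∈ T.pts) (h : T.below x y) : ¬ T.below y x := by
  intro h'
  have hmem : {z | z = x ∨ z = y} ∈ 𝓜.Sets :=
    DefPred.mem_sets (P := fun z => z = x ∨ z = y) h𝓜.out inferInstance
  obtain ⟨t, ht, hmin⟩ := T.wf _ hmem (by rintro z (rfl | rfl) <;> assumption) ⟨x, Or.inl rfl⟩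
  rcases ht with rfl | rfl
  · exact hmin y (Or.inr rfl) h'
  · exact hmin x (Or.inl rfl) h

theorem Top.unique (h : T.Top n x t) (h' : T.Top n x u) : t = u := by
  by_contra hne
  exact below_asymm h.1 h'.1 (h'.2.2 t h.1 h.2.1 hne) (h.2.2 u h'.1 h'.2.1 (Ne.symm hne))

theorem Top.congr (h : T.Top n x t) (hxy : T.E n x y) : T.Top n y t :=
  ⟨h.1, hxy.symm.trans h.2.1, fun z hz hyz => h.2.2 z hz (hxy.trans hyz)⟩

theorem Top.self (h : T.Top n x t) : T.Top n t t := h.congr h.2.1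

theorem Top.mono (h : T.Top n t t) (hnm : n ≤ m) : T.Top m t t :=
  ⟨h.1, E.refl m t, fun y hy hty => h.2.2 y hy (hty.mono hnm)⟩

theorem exists_top (n : 𝓜.Num) (hx : x ∈ T.pts) : ∃ k, n ≤ k ∧ T.Top k x x := by
  obtain ⟨m, hm⟩ := T.isTop x hx
  have : T.Top m x x := ⟨hx, E.refl m x, hm⟩
  exact ⟨max n m, le_max_left n m, this.mono (le_max_right n m)⟩

theorem exists_first (n : 𝓜.Num) (hx : x ∈ T.pts) : ∃ t, T.First n x t := by
  obtain ⟨k, hk, hkx⟩ := exists_top n hx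
  obtain ⟨k, ⟨hk, t, ht⟩, hmin⟩ := Num.exists_least (P := fun k => n ≤ k ∧ ∃ t, T.Top k x t)
    ⟨k, hk, x, hkx⟩
  exact ⟨t, k, hk, ht, fun j hj hjk u hu => hmin j hjk ⟨hj, u, hu⟩⟩

theorem FirstAt.le (h : T.FirstAt n k x t) (hm : T.Top m x u) (hnm : n ≤ m) : k ≤ m :=
  not_lt.1 fun hmk => h.2.2 m hnm hmk u hm

theorem FirstAt.unique (h : T.FirstAt n k x t) (h' : T.FirstAt n m x u) : k = m ∧ t = u := by
  obtain rfl : k = m := le_antisymm (h.le h'.2.1 h'.1) (h'.le h.2.1 h.1)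
  exact ⟨rfl, h.2.1.unique h'.2.1⟩

theorem First.unique (h : T.First n x t) (h' : T.First n x u) : t = u := by
  obtain ⟨k, hk⟩ := h
  obtain ⟨m, hm⟩ := h'
  exact (hk.unique hm).2

theorem FirstAt.congr (h : T.FirstAt n k x t) (hxy : T.E k x y) : T.FirstAt n k y t :=
  ⟨h.1, h.2.1.congr hxy, fun j hj hjk u hu => h.2.2 j hj hjk u (hu.congr (hxy.symm.mono hjk.le))⟩

/-- If some class with a top contains both points, then so does the largest class of `x` with a top
from level `n` on. -/
theorem First.congr (h : T.First n x t) (hxy : T.E k x y) (hm : T.Top m x u) (hnm : n ≤ m)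
    (hmk : m ≤ k) : T.First n y t := by
  obtain ⟨l, hl⟩ := h
  exact ⟨l, hl.congr (hxy.mono ((hl.le hm hnm).trans hmk))⟩

theorem First.skip (h : T.First n x t) (hnm : n ≤ m)
    (hm : ∀ j, n ≤ j → j < m → ∀ u, ¬ T.Top j x u) : T.First m x t := by
  obtain ⟨k, hk⟩ := h
  exact ⟨k, not_lt.1 fun hkm => hm k hk.1 hkm t hk.2.1, hk.2.1,
    fun j hj hjk => hk.2.2 j (hnm.trans hj) hjk⟩

/-- Different first tops mean that no common class from level `n` on has a top. So the first tops
are the same when computed at the splitting level, where the order compares them. -/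
theorem lt_of_first (hx : x ∈ T.pts) (hy : y ∈ T.pts) (hxy : T.E n x y) (ht : T.First n x t)
    (hu : T.First n y u) (htu : t < u) : T.Lt x y := by
  have hne : x ≠ y := by
    rintro rfl
    exact htu.ne (ht.unique hu)
  obtain ⟨k, hk, hkB⟩ := exists_split hx hy hne
  have hnk : n ≤ k := hxy.lt_of_not hkB
  have hno : ∀ j, n ≤ j → j ≤ k → ∀ v, ¬ T.Top j x v := fun j hj hjk v hv =>
    htu.ne ((ht.congr hk hv hj hjk).unique hu)
  refine ⟨hx, hy, k, hk, hkB, Or.inr ⟨hno k hnk le_rfl, t, u, ht.skip hnk fun j hj hjk =>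
    hno j hj hjk.le, hu.skip hnk fun j hj hjk v hv => hno j hj hjk.le v ?_, htu⟩⟩
  exact hv.congr (hk.symm.mono hjk.le)

/-- A weak converse of `lt_of_first`: equality occurs when the two points share a class with a top.
-/
theorem Lt.first_le (h : T.Lt x y) (hxy : T.E n x y) (ht : T.First n x t) (hu : T.First n y u) :
    t ≤ u := by
  obtain ⟨hx, hy, k, hk, hkB, hcmp⟩ := h
  have hnk : n ≤ k := hxy.lt_of_not hkB
  by_cases hno : ∀ j, n ≤ j → j ≤ k → ∀ v, ¬ T.Top j x v
  · rcases hcmp with ⟨v, hv, -⟩ | ⟨-, t', u', ht', hu', h⟩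
    · exact absurd hv (hno k hnk le_rfl v)
    · rw [(ht.skip hnk fun j hj hjk => hno j hj hjk.le).unique ht', (hu.skip hnk
        fun j hj hjk v hv => hno j hj hjk.le v (hv.congr (hk.symm.mono hjk.le))).unique hu']
      exact h.le
  · push Not at hno
    obtain ⟨j, hj, hjk, v, hv⟩ := hno
    exact ((ht.congr hk hv hj hjk).unique hu).le

theorem Lt.irrefl (x : 𝓜.Num) : ¬ T.Lt x x := fun ⟨_, _, _, _, h, _⟩ => h Iff.rfl

theorem lt_of_top (hx : x ∈ T.pts) (hy : y ∈ T.pts) (ht : T.Top n x t) (hxy : T.E n x y)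
    (hyt : T.B y n ↔ T.B t n) (hxt : ¬ (T.B x n ↔ T.B t n)) : T.Lt x y :=
  ⟨hx, hy, n, hxy, fun h => hxt (h.trans hyt), Or.inl ⟨t, ht, hxt, hyt⟩⟩

theorem Lt.trans (h : T.Lt x y) (h' : T.Lt y z) : T.Lt x z := by
  have hxy := h
  have hyz := h'
  obtain ⟨hx, hy, n, hn, hnB, hcmp⟩ := h
  obtain ⟨-, hz, m, hm, hmB, hcmp'⟩ := h'
  -- First tops increase weakly along the order, so one strict increase suffices. The earlier of the
  -- two splits decides which of the comparisons is used.
  have key : ∀ k, T.E k x y → T.E k y z → (∀ t u w, T.First k x t → T.First k y u →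
      T.First k z w → t < u ∨ u < w) → T.Lt x z := by
    intro k hkxy hkyz hlt
    obtain ⟨t, ht⟩ := exists_first k hx
    obtain ⟨u, hu⟩ := exists_first k hy
    obtain ⟨w, hw⟩ := exists_first k hz
    refine lt_of_first hx hz (hkxy.trans hkyz) ht hw ?_
    rcases hlt t u w ht hu hw with h | h
    · exact h.trans_le (hyz.first_le hkyz hu hw)
    · exact (hxy.first_le hkxy ht hu).trans_lt h
  rcases lt_or_ge m n with hmn | hnm
  · rcases hcmp' with ⟨t, ht, h₁, h₂⟩ | ⟨-, t', u', ht', hu', htu⟩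
    · exact lt_of_top hx hz (ht.congr (hn.symm.mono hmn.le)) ((hn.mono hmn.le).trans hm) h₂
        fun h => h₁ ((hn m hmn).symm.trans h)
    · refine key m (hn.mono hmn.le) hm fun t u w _ hu hw => Or.inr ?_
      rwa [hu.unique ht', hw.unique hu']
  · rcases hcmp with ⟨t, ht, h₁, h₂⟩ | ⟨-, t', u', ht', hu', htu⟩
    · rcases hnm.lt_or_eq with hnm | rfl
      · exact lt_of_top hx hz ht (hn.trans (hm.mono hnm.le)) ((hm n hnm).symm.trans h₂) h₁
      -- Two splits at the same level of a class with a top are impossible: `y` would be both on the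
      -- side of the top and off it.
      · rcases hcmp' with ⟨t', ht', h₃, -⟩ | ⟨h₃, -⟩
        · obtain rfl := ht.unique (ht'.congr hn.symm)
          exact absurd h₂ h₃
        · exact absurd (ht.congr hn) (h₃ t)
    · refine key n hn (hm.mono hnm) fun t u w ht hu _ => Or.inl ?_
      rwa [ht.unique ht', hu.unique hu']

theorem Lt.asymm (h : T.Lt x y) : ¬ T.Lt y x := fun h' => Lt.irrefl x (h.trans h')

theorem Lt.total (hx : x ∈ T.pts) (hy : y ∈ T.pts) (hxy : x ≠ y) : T.Lt x y ∨ T.Lt y x := by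
  obtain ⟨n, hn, hnB⟩ := exists_split hx hy hxy
  by_cases htop : ∃ t, T.Top n x t
  · obtain ⟨t, ht⟩ := htop
    by_cases hxt : T.B x n ↔ T.B t n
    · exact Or.inr (lt_of_top hy hx (ht.congr hn) hn.symm hxt fun h => hnB (hxt.trans h.symm))
    · exact Or.inl (lt_of_top hx hy ht hn (by tauto) hxt)
  · obtain ⟨t, ht⟩ := exists_first n hx
    obtain ⟨u, hu⟩ := exists_first n hy
    rcases lt_trichotomy t u with h | rfl | h
    · exact Or.inl (lt_of_first hx hy hn ht hu h)
    -- With a common first top, which occurs above level `n`, both points agree with it on the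
    -- `n`-th set, contrary to the split.
    · obtain ⟨k, hk⟩ := ht
      obtain ⟨m, hm⟩ := hu
      have hkn : n < k := hk.1.lt_of_ne (by rintro rfl; exact htop ⟨t, hk.2.1⟩)
      have hmn : n < m := hm.1.lt_of_ne (by rintro rfl; exact htop ⟨t, hm.2.1.congr hn.symm⟩)
      exact absurd ((hk.2.1.2.1 n hkn).trans (hm.2.1.2.1 n hmn).symm) hnB
    · exact Or.inr (lt_of_first hy hx hn.symm hu ht h)

/-- A class with a point of maximal rank is convex. -/
theorem Lt.congr_left (h : T.Lt x z) (ht : T.Top k x t) (hy : y ∈ T.pts) (hxy : T.E k x y)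
    (hxz : ¬ T.E k x z) : T.Lt y z := by
  obtain ⟨hx, hz, n, hn, hnB, hcmp⟩ := h
  have hnk : n < k := not_le.1 fun h => hxz (hn.mono h)
  have hn' : T.E n y z := (hxy.symm.mono hnk.le).trans hn
  rcases hcmp with ⟨u, hu, h₁, h₂⟩ | ⟨-, u, v, hu, hv, huv⟩
  · exact lt_of_top hy hz (hu.congr (hxy.mono hnk.le)) hn' h₂ fun h => h₁ ((hxy n hnk).trans h)
  · exact lt_of_first hy hz hn' (hu.congr hxy ht hnk.le le_rfl) hv huv

theorem Lt.congr_right (h : T.Lt z x) (ht : T.Top k x t) (hy : y ∈ T.pts) (hxy : T.E k x y)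
    (hxz : ¬ T.E k x z) : T.Lt z y := by
  refine (Lt.total h.1 hy ?_).resolve_right fun h' => h.asymm (h'.congr_left (ht.congr hxy) h.2.1
    hxy.symm fun h'' => hxz (hxy.trans h''))
  rintro rfl
  exact hxz hxy

/-- At the level where `y` splits from `t`, the point `t` is still the top, and its side comes last.
-/
theorem Top.lt (ht : T.Top k t t) (hy : y ∈ T.pts) (hty : T.E k t y) (hne : y ≠ t) :
    T.Lt y t := by
  obtain ⟨m, hm, hmB⟩ := exists_split hy ht.1 hne
  exact lt_of_top hy ht.1 ((ht.mono (hty.symm.lt_of_not hmB)).congr hm.symm) hm Iff.rfl hmB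

/-! ### Least elements, by minimal rank -/

section WellOrder

variable {A : Set 𝓜.Num}

variable (T A) in
/-- The part of `A` in the class of `x` at level `n` is a nonempty initial segment of `A`. -/
def Init (n x : 𝓜.Num) : Prop :=
  (∃ a, a ∈ A ∧ T.E n x a) ∧
    ∀ y, y ∈ T.pts → T.E n x y → ∀ z, z ∈ A → ¬ T.E n x z → T.Lt y z

/-- The maximal subclasses with a top are ordered by the codes of their tops; the first one that
meets `A` inherits the initial segment property. -/
theorem Init.exists_top [hA : Fact (A ∈ 𝓜.Sets)] (hAX : A ⊆ T.pts) (h : T.Init A n x) :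
    ∃ t k, T.Top k t t ∧ T.E n x t ∧ T.Init A k t := by
  obtain ⟨⟨a, ha, hxa⟩, hinit⟩ := h
  obtain ⟨t, ht⟩ := exists_first n (hAX ha)
  obtain ⟨t, ⟨a, ha, hxa, k, hk⟩, hmin⟩ := Num.exists_least
    (P := fun t => ∃ a, a ∈ A ∧ T.E n x a ∧ T.First n a t) ⟨t, a, ha, hxa, ht⟩
  have hat : T.E k a t := hk.2.1.2.1
  refine ⟨t, k, hk.2.1.self, hxa.trans (hat.mono hk.1), ⟨a, ha, hat.symm⟩, ?_⟩
  intro y hy hty z hz htz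
  have hxy : T.E n x y := hxa.trans ((hat.trans hty).mono hk.1)
  by_cases hxz : T.E n x z
  · obtain ⟨w, hw⟩ := exists_first n (hAX hz)
    refine lt_of_first hy (hAX hz) (hxy.symm.trans hxz) ⟨k, hk.congr (hat.trans hty)⟩ hw ?_
    refine (not_lt.1 fun h => hmin w h ⟨z, hz, hxz, hw⟩).lt_of_ne ?_
    rintro rfl
    obtain ⟨m, hm⟩ := hw
    obtain rfl := ((hk.congr hat).unique (hm.congr hm.2.1.2.1)).1
    exact htz hm.2.1.2.1.symm
  · exact hinit y hy hxy z hz hxz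

/-- The first piece splitting off from `t` that meets `A` precedes the remaining points of `A` in
the class. Being a piece without `t`, it contains only points below `t`, so its subclass found by
`Init.exists_top` has a top below `t`. -/
theorem Init.exists_below [hA : Fact (A ∈ 𝓜.Sets)] (hAX : A ⊆ T.pts) (h : T.Init A k t)
    (ht : T.Top k t t) (hy : y ∈ A) (hty : T.E k t y) (hne : y ≠ t) :
    ∃ s m, T.Top m s s ∧ T.Init A m s ∧ T.below s t := by
  obtain ⟨m, hm, hmB⟩ := exists_split ht.1 (hAX hy) hne.symm
  obtain ⟨m, ⟨y, hy, hty, hm, hmB⟩, hmin⟩ := Num.exists_least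
    (P := fun m => ∃ y, y ∈ A ∧ T.E k t y ∧ T.E m t y ∧ ¬ (T.B t m ↔ T.B y m)) ⟨m, y, hy, hty, hm, hmB⟩
  have hkm : k ≤ m := hty.lt_of_not hmB
  have hm1 : m ≤ m + 1 := (Num.lt_succ_iff.2 le_rfl).le
  have hinit : T.Init A (m + 1) y := by
    refine ⟨⟨y, hy, E.refl _ y⟩, fun y' hy' hyy' z hz hyz => ?_⟩
    obtain ⟨hyy', hyB⟩ := E_succ.1 hyy'
    by_cases htz : T.E k t z
    · have hmz : T.E m t z := by
        by_contra hmz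
        obtain ⟨l, hl, hlB⟩ := exists_split_of_not (T := T) (x := t) (y := z) (by
          by_contra! hc
          exact hmz fun i _ => hc i)
        exact hmin l (not_le.1 fun h => hmz (hl.mono h)) ⟨z, hz, htz, hl, hlB⟩
      have hB : T.B z m ↔ T.B t m := by
        by_contra hB
        exact hyz (E_succ.2 ⟨hm.symm.trans hmz, by tauto⟩)
      have hty' : T.E m t y' := hm.trans hyy'
      exact lt_of_top hy' (hAX hz) ((ht.mono hkm).congr hty') (hty'.symm.trans hmz) hB (by tauto)
    · exact h.2 y' hy' ((hm.trans hyy').mono hkm) z hz htz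
  obtain ⟨s, l, hs, hys, hinit'⟩ := hinit.exists_top hAX
  obtain ⟨hys, hsB⟩ := E_succ.1 hys
  refine ⟨s, l, hs, hinit', ht.2.2 s hs.1 ((hm.trans hys).mono hkm) ?_⟩
  rintro rfl
  exact hmB hsB.symm

/-- Take a top of minimal rank whose class meets `A` in an initial segment. By `Init.exists_below`
the class contains no point of `A` other than the top itself. -/
theorem exists_minimal (hA : A ∈ 𝓜.Sets) (hAX : A ⊆ T.pts) (hne : A.Nonempty) :
    ∃ a ∈ A, ∀ b ∈ A, ¬ T.Lt b a := by
  have : Fact (A ∈ 𝓜.Sets) := ⟨hA⟩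
  obtain ⟨a, ha⟩ := hne
  -- The class of level `0` is the whole space.
  have hinit : T.Init A 0 a := ⟨⟨a, ha, E.refl 0 a⟩,
    fun y _ _ z _ h => absurd (fun i hi => absurd hi not_lt_zero) h⟩
  obtain ⟨t₀, k₀, hk₀, -, ht₀⟩ := hinit.exists_top hAX
  have hmem : {t | ∃ k, T.Top k t t ∧ T.Init A k t} ∈ 𝓜.Sets :=
    DefPred.mem_sets (P := fun t => ∃ k, T.Top k t t ∧ T.Init A k t) h𝓜.out (by
      unfold Init
      infer_instance)
  obtain ⟨t, ⟨k, hk, ht⟩, hmin⟩ := T.wf _ hmem (fun t ht => ht.choose_spec.1.1) ⟨t₀, k₀, hk₀, ht₀⟩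
  have hsing : ∀ b ∈ A, T.E k t b → b = t := by
    intro b hb htb
    by_contra hbt
    obtain ⟨s, m, hs, hs', hst⟩ := ht.exists_below hAX hk hb htb hbt
    exact hmin s ⟨m, hs, hs'⟩ hst
  obtain ⟨b, hb, htb⟩ := ht.1
  obtain rfl := hsing b hb htb
  refine ⟨b, hb, fun z hz hzb => ?_⟩
  by_cases hbz : T.E k b z
  · rw [hsing z hz hbz] at hzb
    exact Lt.irrefl b hzb
  · exact hzb.asymm (ht.2 b hk.1 (E.refl k b) z hz hbz)

end WellOrder

end RankedTree

end SOA

/-! ### From a Cantor–Bendixson rank to a ranked tree -/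

namespace SOA

variable {𝓜 : SOStructure.{u}} {Γ : Type u} [Ctx 𝓜 Γ]

namespace SOStructure.LinOrd

variable (R : 𝓜.LinOrd)

instance : Fact (R.field ∈ 𝓜.Sets) := ⟨R.field_mem⟩

instance {f g : Γ → 𝓜.Num} [hf : DefFun f] [hg : DefFun g] : DefPred fun c => R.lt (f c) (g c) :=
  DefPred.mem R.rel_mem (hf.code hg)

variable {R}

theorem IsWellOrder.exists_least (h𝓜 : 𝓜.IsModelACA0) (hR : R.IsWellOrder) {P : 𝓜.Num → Prop}
    [hP : DefSet P] (h : ∃ r ∈ R.field, P r) : ∃ r ∈ R.field, P r ∧ ∀ s, R.lt s r → ¬ P s := by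
  obtain ⟨r, hr, hPr⟩ := h
  obtain ⟨m, ⟨hm, hPm⟩, hmin⟩ := hR {r | r ∈ R.field ∧ P r}
    (DefPred.mem_sets (P := fun r => r ∈ R.field ∧ P r) h𝓜 inferInstance) (fun _ h => h.1)
    ⟨r, hr, hPr⟩
  exact ⟨m, hm, hPm, fun s hs hPs => hmin s ⟨(R.rel_field _ _ hs).1, hPs⟩ hs⟩

end SOStructure.LinOrd

namespace SOStructure.CSCS

variable {X : 𝓜.CSCS} {R : 𝓜.LinOrd} {Z : Set 𝓜.Num}

namespace IsRankWith

/-- Consider the least `r` at which some inclusion fails: derivatives shrink at successors, and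
limits are intersections. -/
theorem antitone (h𝓜 : 𝓜.IsModelACA0) (h : X.IsRankWith R Z) {s r x : 𝓜.Num} (hsr : R.lt s r)
    (hx : x ∈ 𝓜.sec Z r) : x ∈ 𝓜.sec Z s := by
  have : Fact (Z ∈ 𝓜.Sets) := ⟨h.mem⟩
  by_contra hxs
  have : DefSet fun r => ∃ s x, R.lt s r ∧ x ∈ 𝓜.sec Z r ∧ ¬ x ∈ 𝓜.sec Z s := ⟨inferInstance⟩
  obtain ⟨r, hr, ⟨s, x, hsr, hx, hxs⟩, hmin⟩ := h.wellOrder.exists_least h𝓜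
    (P := fun r => ∃ s x, R.lt s r ∧ x ∈ 𝓜.sec Z r ∧ ¬ x ∈ 𝓜.sec Z s)
    ⟨r, (R.rel_field _ _ hsr).2, s, x, hsr, hx, hxs⟩
  have hbot : ¬ R.IsBot r := fun hb => hb.2 s (R.rel_field _ _ hsr).1 hsr
  by_cases hq : ∃ q, R.IsSucc q r
  · obtain ⟨q, hq⟩ := hq
    rw [h.succ q r hq] at hx
    rcases R.total s (R.rel_field _ _ hsr).1 q (R.rel_field _ _ hq.1).1 with hsq | rfl | hqs
    · exact hmin q hq.1 ⟨s, x, hsq, hx.1, hxs⟩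
    · exact hxs hx.1
    · exact hq.2 ⟨s, hqs, hsr⟩
  · rw [h.limit r ⟨hr, hbot, hq⟩] at hx
    exact hxs (hx s hsr)

/-- The intersection of all `X_r` is its own derivative, so in a scattered space it is empty. -/
theorem exists_notMem (h𝓜 : 𝓜.IsModelACA0) (hX : X.IsScattered) (h : X.IsRankWith R Z) {x : 𝓜.Num}
    (hx : x ∈ X.pts) : ∃ r ∈ R.field, x ∉ 𝓜.sec Z r := by
  have : Fact (Z ∈ 𝓜.Sets) := ⟨h.mem⟩
  by_contra! hc
  obtain ⟨y, hy⟩ := hX {x | x ∈ X.pts ∧ ∀ r ∈ R.field, x ∈ 𝓜.sec Z r}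
    (DefPred.mem_sets (P := fun x => x ∈ X.pts ∧ ∀ r, r ∈ R.field → x ∈ 𝓜.sec Z r) h𝓜 inferInstance)
    (fun _ h => h.1) ⟨x, hx, hc⟩
  have hy' := hy.1
  rw [← h.stable] at hy'
  exact hy'.2 hy

/-- The point `x` has smaller Cantor–Bendixson rank than `y`. -/
def Below (𝓜 : SOStructure.{u}) (R : 𝓜.LinOrd) (Z : Set 𝓜.Num) (x y : 𝓜.Num) : Prop :=
  ∃ r, r ∈ R.field ∧ ¬ x ∈ 𝓜.sec Z r ∧ y ∈ 𝓜.sec Z r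

instance [Fact (Z ∈ 𝓜.Sets)] : DefRel (Below 𝓜 R Z) := ⟨by
  unfold Below
  infer_instance⟩

theorem exists_minimal (h𝓜 : 𝓜.IsModelACA0) (hX : X.IsScattered) (h : X.IsRankWith R Z)
    {A : Set 𝓜.Num} (hA : A ∈ 𝓜.Sets) (hAX : A ⊆ X.pts) (hne : A.Nonempty) :
    ∃ t ∈ A, ∀ s ∈ A, ¬ Below 𝓜 R Z s t := by
  have : Fact (Z ∈ 𝓜.Sets) := ⟨h.mem⟩
  have : Fact (A ∈ 𝓜.Sets) := ⟨hA⟩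
  obtain ⟨x, hx⟩ := hne
  obtain ⟨r, hr, hxr⟩ := h.exists_notMem h𝓜 hX (hAX hx)
  have : DefSet fun r => ∃ x, x ∈ A ∧ ¬ x ∈ 𝓜.sec Z r := ⟨inferInstance⟩
  obtain ⟨r, hr, ⟨t, ht, htr⟩, hmin⟩ := h.wellOrder.exists_least h𝓜
    (P := fun r => ∃ x, x ∈ A ∧ ¬ x ∈ 𝓜.sec Z r) ⟨r, hr, x, hx, hxr⟩
  refine ⟨t, ht, ?_⟩
  rintro s hs ⟨q, hq, hsq, htq⟩
  rcases R.total q hq r hr with hqr | rfl | hrq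
  · exact hmin q hqr ⟨s, hs, hsq⟩
  · exact htr htq
  · exact htr (h.antitone h𝓜 hrq htq)

/-- The least `r` with `x ∉ X_r` is a successor `q + 1`, so `x` is isolated in `X_q`; the other
points of an isolating neighbourhood have left by stage `q`. -/
theorem exists_nhds (h𝓜 : 𝓜.IsModelACA0) (hX : X.IsScattered) (h : X.IsRankWith R Z) {x : 𝓜.Num}
    (hx : x ∈ X.pts) : ∃ i, x ∈ X.U i ∧ ∀ y ∈ X.U i, y ≠ x → Below 𝓜 R Z y x := by
  have : Fact (Z ∈ 𝓜.Sets) := ⟨h.mem⟩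
  have : DefSet fun r => ¬ x ∈ 𝓜.sec Z r := ⟨inferInstance⟩
  obtain ⟨r, hr, hxr, hmin⟩ := h.wellOrder.exists_least h𝓜 (P := fun r => ¬ x ∈ 𝓜.sec Z r)
    (h.exists_notMem h𝓜 hX hx)
  have hbot : ¬ R.IsBot r := fun hb => hxr (by rw [h.bot r hb]; exact hx)
  have hq : ∃ q, R.IsSucc q r := by
    by_contra hq
    refine hxr ?_
    rw [h.limit r ⟨hr, hbot, hq⟩]
    exact fun s hs => not_not.1 (hmin s hs)
  obtain ⟨q, hq⟩ := hq
  have hxq : x ∈ 𝓜.sec Z q := not_not.1 (hmin q hq.1)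
  rw [h.succ q r hq] at hxr
  obtain ⟨-, i, hi, hiso⟩ : X.IsIsolated (𝓜.sec Z q) x := by_contra fun h' => hxr ⟨hxq, h'⟩
  exact ⟨i, hi, fun y hy hyx => ⟨q, (R.rel_field _ _ hq.1).1, fun hyq => hyx (hiso y hyq hy), hxq⟩⟩

end IsRankWith

/-- A ranked tree on the points of `X` whose classes form a clopen basis of `X`. -/
structure IsTreeOf [Fact 𝓜.IsModelACA0] (X : 𝓜.CSCS) (T : RankedTree 𝓜) : Prop where
  pts_eq : T.pts = X.pts
  clopen : ∀ n, X.ClopenProp fun x => T.B x n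
  basis : ∀ x ∈ X.pts, ∀ i, x ∈ X.U i → ∃ n, ∀ y ∈ X.pts, T.E n x y → y ∈ X.U i

theorem exists_tree [h𝓜 : Fact 𝓜.IsModelACA0] (hT3 : X.IsT3) (hX : X.IsScattered)
    (hrank : X.HasRank) : ∃ T : RankedTree 𝓜, X.IsTreeOf T := by
  obtain ⟨R, Z, h⟩ := hrank
  have : Fact (Z ∈ 𝓜.Sets) := ⟨h.mem⟩
  obtain ⟨B, hB, hclopen, hbasis⟩ := exists_clopen_basis hT3
  have hbasis' : ∀ x ∈ X.pts, ∀ i, x ∈ X.U i →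
      ∃ n, ∀ y ∈ X.pts, (∀ i < n, (B x i ↔ B y i)) → y ∈ X.U i := by
    intro x hx i hi
    obtain ⟨n, hn, hsub⟩ := hbasis x hx i hi
    -- Level `n + 1` is the first one whose classes take the `n`-th set into account.
    exact ⟨n + 1, fun y hy hxy => hsub y hy ((hxy n (Num.lt_succ_iff.2 le_rfl)).1 hn)⟩
  refine ⟨⟨X.pts, B, IsRankWith.Below 𝓜 R Z, X.pts_mem, hB, inferInstance, ?_, ?_, ?_⟩,
    rfl, hclopen, hbasis'⟩
  · intro x hx y hy hxy
    by_contra! hc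
    obtain ⟨i, hi⟩ := hT3.1 x hx y hy hxy
    by_cases hxi : x ∈ X.U i
    · obtain ⟨n, hsub⟩ := hbasis' x hx i hxi
      exact hi (iff_of_true hxi (hsub y hy fun j _ => hc j))
    · have hyi : y ∈ X.U i := by tauto
      obtain ⟨n, hsub⟩ := hbasis' y hy i hyi
      exact hxi (hsub x hx fun j _ => (hc j).symm)
  · exact fun A hA hAX hne => h.exists_minimal h𝓜.out hX hA hAX hne
  · intro x hx
    obtain ⟨i, hi, hbelow⟩ := h.exists_nhds h𝓜.out hX hx
    obtain ⟨n, hn⟩ := hbasis' x hx i hi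
    exact ⟨n, fun y hy hxy hyx => hbelow y (hn y hy hxy) hyx⟩

end SOStructure.CSCS

/-! ### The lexicographic product with the numbers -/

namespace RankedTree

variable [h𝓜 : Fact 𝓜.IsModelACA0]

open SOStructure

section Order

variable (T : RankedTree 𝓜)

/-- The set of all pairs of a point and a number. -/
def prodField : Set 𝓜.Num := {w | ∃ x i, w = 𝓜.pair x i ∧ x ∈ T.pts}

/-- The lexicographic order of the pairs of a point and a number. -/
def prodRel : Set 𝓜.Num := {w | ∃ x i y j, w = 𝓜.pair (𝓜.pair x i) (𝓜.pair y j) ∧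
  (T.Lt x y ∨ (x = y ∧ x ∈ T.pts ∧ i < j))}

variable {T}

theorem mem_prodField {x i : 𝓜.Num} : 𝓜.pair x i ∈ T.prodField ↔ x ∈ T.pts := by
  constructor
  · rintro ⟨y, j, h, hy⟩
    obtain ⟨rfl, rfl⟩ := Num.pair_inj h
    exact hy
  · exact fun h => ⟨x, i, rfl, h⟩

theorem mem_prodRel {x i y j : 𝓜.Num} : 𝓜.pair (𝓜.pair x i) (𝓜.pair y j) ∈ T.prodRel ↔
    T.Lt x y ∨ (x = y ∧ x ∈ T.pts ∧ i < j) := by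
  constructor
  · rintro ⟨x', i', y', j', h, hlt⟩
    obtain ⟨h₁, h₂⟩ := Num.pair_inj h
    obtain ⟨rfl, rfl⟩ := Num.pair_inj h₁
    obtain ⟨rfl, rfl⟩ := Num.pair_inj h₂
    exact hlt
  · exact fun h => ⟨x, i, y, j, rfl, h⟩

theorem prodRel_cases {a b : 𝓜.Num} (h : 𝓜.pair a b ∈ T.prodRel) : ∃ x i y j, a = 𝓜.pair x i ∧
    b = 𝓜.pair y j ∧ (T.Lt x y ∨ (x = y ∧ x ∈ T.pts ∧ i < j)) := by
  obtain ⟨x, i, y, j, h, hlt⟩ := h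
  obtain ⟨rfl, rfl⟩ := Num.pair_inj h
  exact ⟨x, i, y, j, rfl, rfl, hlt⟩

variable (T) in
/-- The lexicographic order of the pairs of a point and a number. -/
def prodOrder : 𝓜.LinOrd where
  field := T.prodField
  rel := T.prodRel
  field_mem := DefPred.mem_sets (P := fun w => ∃ x i, w = 𝓜.pair x i ∧ x ∈ T.pts) h𝓜.out inferInstance
  rel_mem := DefPred.mem_sets (P := fun w => ∃ x i y j, w = 𝓜.pair (𝓜.pair x i) (𝓜.pair y j) ∧
    (T.Lt x y ∨ (x = y ∧ x ∈ T.pts ∧ i < j))) h𝓜.out inferInstance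
  rel_field a b h := by
    obtain ⟨x, i, y, j, rfl, rfl, hlt⟩ := prodRel_cases h
    rw [mem_prodField, mem_prodField]
    rcases hlt with h | ⟨rfl, h, -⟩
    · exact ⟨h.1, h.2.1⟩
    · exact ⟨h, h⟩
  irrefl a h := by
    obtain ⟨x, i, y, j, rfl, h', h⟩ := prodRel_cases h
    obtain ⟨rfl, rfl⟩ := Num.pair_inj h'
    rcases h with h | ⟨-, -, h⟩
    · exact Lt.irrefl x h
    · exact lt_irrefl i h
  trans a b c h h' := by
    obtain ⟨x, i, y, j, rfl, rfl, hlt⟩ := prodRel_cases h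
    obtain ⟨y', j', z, k, e, rfl, hlt'⟩ := prodRel_cases h'
    obtain ⟨rfl, rfl⟩ := Num.pair_inj e
    rw [mem_prodRel]
    rcases hlt with h | ⟨rfl, hx, h⟩ <;> rcases hlt' with h' | ⟨rfl, -, h'⟩
    · exact Or.inl (h.trans h')
    · exact Or.inl h
    · exact Or.inl h'
    · exact Or.inr ⟨rfl, hx, h.trans h'⟩
  total a ha b hb := by
    obtain ⟨x, i, rfl, hx⟩ := ha
    obtain ⟨y, j, rfl, hy⟩ := hb
    simp only [mem_prodRel]
    by_cases hxy : x = y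
    · subst hxy
      rcases lt_trichotomy i j with h | rfl | h
      · exact Or.inl (Or.inr ⟨rfl, hx, h⟩)
      · exact Or.inr (Or.inl rfl)
      · exact Or.inr (Or.inr (Or.inr ⟨rfl, hx, h⟩))
    · exact (Lt.total hx hy hxy).imp Or.inl fun h => Or.inr (Or.inl h)

theorem prodOrder_lt {x i y j : 𝓜.Num} : T.prodOrder.lt (𝓜.pair x i) (𝓜.pair y j) ↔
    T.Lt x y ∨ (x = y ∧ x ∈ T.pts ∧ i < j) := mem_prodRel

theorem prodOrder_isWellOrder : T.prodOrder.IsWellOrder := by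
  intro A hA hAW ⟨w, hw⟩
  have : Fact (A ∈ 𝓜.Sets) := ⟨hA⟩
  obtain ⟨x, i, rfl, hx⟩ := hAW hw
  obtain ⟨x, ⟨i, hi⟩, hmin⟩ := exists_minimal (T := T) (A := {x | ∃ i, 𝓜.pair x i ∈ A})
    (DefPred.mem_sets (P := fun x => ∃ i, 𝓜.pair x i ∈ A) h𝓜.out inferInstance)
    (fun x ⟨i, hi⟩ => mem_prodField.1 (hAW hi)) ⟨x, i, hw⟩
  obtain ⟨i, hi, hi'⟩ := Num.exists_least (P := fun i => 𝓜.pair x i ∈ A) ⟨i, hi⟩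
  refine ⟨_, hi, fun b hb hlt => ?_⟩
  obtain ⟨y, j, rfl, -⟩ := hAW hb
  rcases prodOrder_lt.1 hlt with h | ⟨rfl, -, h⟩
  · exact hmin y ⟨j, hb⟩ h
  · exact hi' j h hb

end Order

end RankedTree

/-! ### The embedding is a homeomorphism onto its image -/

namespace SOStructure.CSCS

open RankedTree

variable [h𝓜 : Fact 𝓜.IsModelACA0] {X : 𝓜.CSCS} {T : RankedTree 𝓜}

theorem IsTreeOf.exists_nhds (hT : X.IsTreeOf T) {x : 𝓜.Num} (hx : x ∈ X.pts) (n : 𝓜.Num) :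
    ∃ j, x ∈ X.U j ∧ ∀ y, y ∈ X.U j → T.E n x y := by
  refine Num.ind (P := fun n => ∃ j, x ∈ X.U j ∧ ∀ y, y ∈ X.U j → T.E n x y) ?_ ?_ n
  · obtain ⟨j, hj⟩ := X.cover x hx
    exact ⟨j, hj, fun y _ i hi => absurd hi not_lt_zero⟩
  · rintro n ⟨j, hj, hjE⟩
    obtain ⟨i, hi, hiB⟩ := hT.clopen n x hx
    obtain ⟨m, hm, hmij⟩ := exists_inter hi hj
    exact ⟨m, hm, fun y hy => E_succ.2 ⟨hjE y (hmij y hy).2, (hiB y (hmij y hy).1).symm⟩⟩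

/-- The second coordinate of the image of `x` is `1` if `x` is isolated, and `0` otherwise. -/
def Height (X : 𝓜.CSCS) (x i : 𝓜.Num) : Prop :=
  x ∈ X.pts ∧ ((i = 1 ∧ ∃ n, x ∈ X.U n ∧ ∀ y, y ∈ X.U n → y = x) ∨
    (i = 0 ∧ ¬ ∃ n, x ∈ X.U n ∧ ∀ y, y ∈ X.U n → y = x))

omit h𝓜 in
theorem Height.unique {x i j : 𝓜.Num} (hi : X.Height x i) (hj : X.Height x j) : i = j := by
  obtain ⟨-, ⟨rfl, h⟩ | ⟨rfl, h⟩⟩ := hi <;> obtain ⟨-, ⟨rfl, h'⟩ | ⟨rfl, h'⟩⟩ := hj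
  · rfl
  · exact absurd h h'
  · exact absurd h' h
  · rfl

omit h𝓜 in
theorem exists_height {x : 𝓜.Num} (hx : x ∈ X.pts) : ∃ i, X.Height x i := by
  by_cases h : ∃ n, x ∈ X.U n ∧ ∀ y, y ∈ X.U n → y = x
  · exact ⟨1, hx, Or.inl ⟨rfl, h⟩⟩
  · exact ⟨0, hx, Or.inr ⟨rfl, h⟩⟩

instance : DefRel X.Height := ⟨by
  unfold Height
  infer_instance⟩

/-- The graph of the embedding of the space. -/
def embedding (X : 𝓜.CSCS) : Set 𝓜.Num :=
  {w | ∃ x i, w = 𝓜.pair x (𝓜.pair x i) ∧ X.Height x i}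

theorem mem_embedding {x y : 𝓜.Num} :
    𝓜.pair x y ∈ X.embedding ↔ ∃ i, y = 𝓜.pair x i ∧ X.Height x i := by
  constructor
  · rintro ⟨x', i, h, hi⟩
    obtain ⟨rfl, rfl⟩ := Num.pair_inj h
    exact ⟨i, rfl, hi⟩
  · rintro ⟨i, rfl, hi⟩
    exact ⟨x, i, rfl, hi⟩

/-- For a non-isolated `x`, take a class with top `x` that omits the point of the left end.
Convexity keeps the class to the right of that end, and `x` is its greatest element, so the right
end causes no trouble. -/
theorem IsTreeOf.embedding_continuous (hT : X.IsTreeOf T) {x i : 𝓜.Num} (hi : X.Height x i)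
    (e : Option 𝓜.Num × Option 𝓜.Num) (he : 𝓜.pair x i ∈ T.prodOrder.interval e) :
    ∃ n, x ∈ X.U n ∧ ∀ x' i', X.Height x' i' → x' ∈ X.U n →
      𝓜.pair x' i' ∈ T.prodOrder.interval e := by
  obtain ⟨hx, ⟨rfl, n, hn, hiso⟩ | ⟨rfl, -⟩⟩ := id hi
  · refine ⟨n, hn, fun x' i' hi' hx' => ?_⟩
    obtain rfl := hiso x' hx'
    rwa [hi'.unique hi]
  · have hxT : x ∈ T.pts := hT.pts_eq ▸ hx
    obtain ⟨-, hlo, hhi⟩ := he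
    -- A left end below `(x, 0)` has a first coordinate different from `x`, because `0` is the least
    -- second coordinate; hence some level separates the two points.
    obtain ⟨k₀, hk₀⟩ : ∃ k, ∀ a₀ j₀, 𝓜.pair a₀ j₀ ∈ e.1 → ¬ T.E k x a₀ := by
      rcases he₁ : e.1 with _ | a
      · exact ⟨0, fun a₀ j₀ h => absurd h (by simp)⟩
      · have ha := hlo a (by rw [he₁]; rfl)
        obtain ⟨a₀, j₀, y, j, rfl, h', -⟩ := prodRel_cases ha
        rcases prodOrder_lt.1 ha with h | ⟨-, -, h⟩
        · obtain ⟨n, hn, hnB⟩ := exists_split hxT h.1 (by rintro rfl; exact Lt.irrefl _ h)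
          refine ⟨n + 1, fun a₁ j₁ h₁ h₂ => hnB ?_⟩
          obtain ⟨rfl, rfl⟩ := Num.pair_inj (Option.some.inj h₁)
          exact (E_succ.1 h₂).2
        · exact absurd h not_lt_zero
    obtain ⟨k, hk, htop⟩ := exists_top k₀ hxT
    obtain ⟨n, hn, hnE⟩ := hT.exists_nhds hx k
    refine ⟨n, hn, fun x' i' hi' hx' => ?_⟩
    by_cases hne : x' = x
    · subst hne
      rw [hi'.unique hi]
      exact ⟨mem_prodField.2 hxT, hlo, hhi⟩
    · have hxT' : x' ∈ T.pts := hT.pts_eq ▸ hi'.1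
      have hlt : T.Lt x' x := htop.lt hxT' (hnE x' hx') hne
      refine ⟨mem_prodField.2 hxT', fun a ha => ?_, fun b hb => ?_⟩
      · obtain ⟨a₀, j₀, y, j, rfl, h', -⟩ := prodRel_cases (hlo a ha)
        rcases prodOrder_lt.1 (hlo _ ha) with h | ⟨-, -, h⟩
        · exact prodOrder_lt.2 (Or.inl (h.congr_right htop hxT' (hnE x' hx')
            fun h' => hk₀ a₀ j₀ ha (h'.mono hk)))
        · exact absurd h not_lt_zero
      · obtain ⟨y, j, b₀, j₀, h', rfl, -⟩ := prodRel_cases (hhi b hb)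
        rcases prodOrder_lt.1 (hhi _ hb) with h | ⟨rfl, -, -⟩
        · exact prodOrder_lt.2 (Or.inl (hlt.trans h))
        · exact prodOrder_lt.2 (Or.inl hlt)

theorem IsTreeOf.embedding_open (hT : X.IsTreeOf T) {x i : 𝓜.Num} (hi : X.Height x i) {n : 𝓜.Num}
    (hn : x ∈ X.U n) : ∃ e, 𝓜.pair x i ∈ T.prodOrder.interval e ∧ ∀ x' i', X.Height x' i' →
      𝓜.pair x' i' ∈ T.prodOrder.interval e → x' ∈ X.U n := by
  obtain ⟨hx, ⟨rfl, -⟩ | ⟨rfl, hiso⟩⟩ := id hi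
  · have hxT : x ∈ T.pts := hT.pts_eq ▸ hx
    have h01 : (0 : 𝓜.Num) < 1 := by
      rw [← zero_add (1 : 𝓜.Num)]
      exact Num.lt_succ_iff.2 le_rfl
    -- The neighbours `(x, 0)` and `(x, 2)` isolate the image `(x, 1)`; this is what the height `1`
    -- is for.
    refine ⟨(some (𝓜.pair x 0), some (𝓜.pair x (1 + 1))), ⟨mem_prodField.2 hxT, ?_, ?_⟩, ?_⟩
    · rintro a ⟨⟩
      exact prodOrder_lt.2 (Or.inr ⟨rfl, hxT, h01⟩)
    · rintro b ⟨⟩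
      exact prodOrder_lt.2 (Or.inr ⟨rfl, hxT, Num.lt_succ_iff.2 le_rfl⟩)
    · rintro x' i' - ⟨-, h₁, h₂⟩
      rcases prodOrder_lt.1 (h₁ _ rfl) with h₁ | ⟨rfl, -, -⟩
      · rcases prodOrder_lt.1 (h₂ _ rfl) with h₂ | ⟨rfl, -, -⟩
        · exact absurd h₂ h₁.asymm
        · exact hn
      · exact hn
  · have hxT : x ∈ T.pts := hT.pts_eq ▸ hx
    obtain ⟨k₀, hk₀⟩ := hT.basis x hx n hn
    obtain ⟨k, hk, htop⟩ := exists_top k₀ hxT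
    obtain ⟨m, hm, hmE⟩ := hT.exists_nhds hx k
    push Not at hiso
    -- Since `x` is not isolated, its class contains another point `y`, which precedes its top `x`.
    -- By convexity the interval from `(y, 0)` to `(x, 1)` captures only images of points of the
    -- class.
    obtain ⟨y, hy, hyx⟩ := hiso m hm
    have hyT : y ∈ T.pts := hT.pts_eq ▸ mem_pts hy
    have hlt : T.Lt y x := htop.lt hyT (hmE y hy) hyx
    have h01 : (0 : 𝓜.Num) < 1 := by
      rw [← zero_add (1 : 𝓜.Num)]
      exact Num.lt_succ_iff.2 le_rfl
    refine ⟨(some (𝓜.pair y 0), some (𝓜.pair x 1)), ⟨mem_prodField.2 hxT, ?_, ?_⟩, ?_⟩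
    · rintro a ⟨⟩
      exact prodOrder_lt.2 (Or.inl hlt)
    · rintro b ⟨⟩
      exact prodOrder_lt.2 (Or.inr ⟨rfl, hxT, h01⟩)
    · rintro x' i' hi' ⟨-, h₁, h₂⟩
      refine hk₀ x' hi'.1 (E.mono ?_ hk)
      by_contra hE
      rcases prodOrder_lt.1 (h₂ _ rfl) with h₂ | ⟨rfl, -, -⟩
      · have h₃ : T.Lt x' y := h₂.congr_right htop hyT (hmE y hy) hE
        rcases prodOrder_lt.1 (h₁ _ rfl) with h₁ | ⟨rfl, -, -⟩
        · exact h₁.asymm h₃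
        · exact Lt.irrefl y h₃
      · exact hE (E.refl k x')

theorem IsTreeOf.embedsInWellOrder (hT : X.IsTreeOf T) : X.EmbedsInWellOrder := by
  refine ⟨T.prodOrder, prodOrder_isWellOrder, {w | ∃ x i, w = 𝓜.pair x i ∧ X.Height x i},
    DefPred.mem_sets (P := fun w => ∃ x i, w = 𝓜.pair x i ∧ X.Height x i) h𝓜.out inferInstance, ?_,
    X.embedding, ?_⟩
  · rintro w ⟨x, i, rfl, hi⟩
    exact mem_prodField.2 (hT.pts_eq ▸ hi.1)
  · refine ⟨DefPred.mem_sets (P := fun w => ∃ x i, w = 𝓜.pair x (𝓜.pair x i) ∧ X.Height x i)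
      h𝓜.out inferInstance, ?_, ?_, ?_, ?_, ?_, ?_, ?_⟩ <;> simp only [mem_embedding]
    · rintro x y ⟨i, rfl, hi⟩
      exact ⟨hi.1, x, i, rfl, hi⟩
    · intro x hx
      obtain ⟨i, hi⟩ := exists_height hx
      exact ⟨_, i, rfl, hi⟩
    · rintro x y y' ⟨i, rfl, hi⟩ ⟨j, rfl, hj⟩
      rw [hi.unique hj]
    · rintro x x' y ⟨i, rfl, hi⟩ ⟨j, h, hj⟩
      exact (Num.pair_inj h).1
    · rintro y ⟨x, i, rfl, hi⟩
      exact ⟨x, i, rfl, hi⟩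
    · rintro x y ⟨i, rfl, hi⟩ e he
      obtain ⟨n, hn, h⟩ := hT.embedding_continuous hi e he
      refine ⟨n, hn, ?_⟩
      rintro x' y' ⟨i', rfl, hi'⟩ hx'
      exact h x' i' hi' hx'
    · rintro x y ⟨i, rfl, hi⟩ n hn
      obtain ⟨e, he, h⟩ := hT.embedding_open hi hn
      refine ⟨e, he, ?_⟩
      rintro x' y' ⟨i', rfl, hi'⟩ hx'
      exact h x' i' hi' hx'

end SOStructure.CSCS

end SOA

theorem mainTheorem9 (𝓜 : SOA.SOStructure.{u}) (h𝓜 : 𝓜.IsModelACA0)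
    (X : 𝓜.CSCS) (hT3 : X.IsT3) (hscattered : X.IsScattered) (hrank : X.HasRank) :
    X.EmbedsInWellOrder := by
  have : Fact 𝓜.IsModelACA0 := ⟨h𝓜⟩
  obtain ⟨T, hT⟩ := SOA.SOStructure.CSCS.exists_tree hT3 hscattered hrank
  exact hT.embedsInWellOrder
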